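/- **Model.** A UAV at altitude $h>0$ above the origin of $\mathbb R^2$ serves a typical device at horizontal offset $r_x\sim\mathcal N(0,\eta^2)$, $\eta>0$. A link over ground distance $|r|$ is line-of-sight ($L$) with probability $$p_{\rm LOS}(r)=\Big(1+a\exp\big(-b\,(\tfrac{180}{\pi}\arctan|h/r|-a)\big)\Big)^{-1}$$ (with $\arctan|h/0|=\pi/2$; $a>0$, $b\in\mathbb R$), and non-line-of-sight ($N$) otherwise. In state $k\in\{L,N\}$ the path loss is $(r^2+h^2)^{-\alpha_k/2}$, $\alpha_k>0$, and the power fading gain is Gamma distributed with integer shape $m_k\ge1$ and mean $1$. The interfering devices form a Poisson point process of intensity $\lambda_{\rm DC}=\frac{t_{\rm DC}}{T_s}\cdot\frac{2}{3\sqrt3R^2}$ on $\{x\in\mathbb R^2:\|x\|\ge R/2\}$ (with $R,t_{\rm DC},T_s>0$). Each of them has, independently, a link state (given its distance), a fading gain and an antenna gain $G_\epsilon\in\{G_{dM}G_{uM},G_{dM}G_{um},G_{dm}G_{uM},G_{dm}G_{um}\}$ with probabilities $\mathbb P_\epsilon\in\{c_dc_u,c_d(1-c_u),(1-c_d)c_u,(1-c_d)(1-c_u)\}$,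 where $c_d=\theta_d/2\pi$ and $c_u=\theta_u/2\pi$ with beamwidths $\theta_d,\theta_u\in[0,2\pi]$; main lobe gains are positive and side lobe gains non-negative. The typical device is independent of the interferers. All devices transmit with power $P>0$; the noise power is $\sigma^2\ge0$. Let $I_k\in[0,\infty]$ be the total power received from the interferers in state $k$. If the intended link has state $k$, offset $r$ and fading gain $H_{k}$, then $$\mathrm{SINR}=\frac{PH_{k}G_{dM}G_{uM}(r^2+h^2)^{-\alpha_k/2}}{I_L+I_N+\sigma^2}.$$ The packet is received if $\mathrm{SINR}\ge\theta=2^{\ell/(t_{\rm DC}\zeta W)}-1$, with packet size $\ell>0$, rate penalty $\zeta>0$ and bandwidth $W>0$. Let $S_p$ be the probability of this event, and $(S_p|k)(r)$ its probability when the intended link has state $k$ and offset $r$. **Formula.** With $p_L=p_{\rm LOS}$, $p_N=1-p_{\rm LOS}$, $e^{-\infty}=0$ and $s\ge0$, put $$\mathcal L_{I_k}(s)=\exp\Big\{-2\pi\lambda_{\rm DC}\sum_{\epsilon=1}^4\mathbb P_\epsilon\int_{R/2}^\infty p_k(r)\Big(1-\big(1+\tfrac{sPG_\epsilon(r^2+h^2)^{-\alpha_k/2}}{m_k}\big)^{-m_k}\Big)r\,dr\Big\}.$$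 For positive coefficients $c=(c_L,c_N)$ put $u_{k,n}(r)=\dfrac{c_k\,n\,\theta\,(r^2+h^2)^{\alpha_k/2}}{PG_{dM}G_{uM}}$ and $$F_k^{c}(r)=\sum_{n=1}^{m_k}(-1)^{n+1}\binom{m_k}{n}e^{-u_{k,n}(r)\sigma^2}\,\mathcal L_{I_L}(u_{k,n}(r))\,\mathcal L_{I_N}(u_{k,n}(r)),$$ $$F^{c}=\int_{-\infty}^\infty\big[F^c_L(r)\,p_{\rm LOS}(r)+F^c_N(r)\,(1-p_{\rm LOS}(r))\big]\frac{e^{-r^2/(2\eta^2)}}{\sqrt{2\pi\eta^2}}\,dr .$$ **Theorem 1.** Let $g_k=m_k(m_k!)^{-1/m_k}$. The integrals against the Gaussian density in part 2 and in $F^{g}$, $F^{m}$ converge absolutely. 1. $\mathbb E[e^{-sI_k}]=\mathcal L_{I_k}(s)$ for $k\in\{L,N\}$ and $s\ge0$. 2. Exactly, $$S_p=\int_{-\infty}^{\infty}\big[(S_p|L)(r)\,p_{\rm LOS}(r)+(S_p|N)(r)\,(1-p_{\rm LOS}(r))\big]\frac{e^{-r^2/(2\eta^2)}}{\sqrt{2\pi\eta^2}}\,dr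 .$$ Moreover $(S_p|k)(r)=\mathbb E\big[\overline F_k(T_k(r))\big]$ for all $k,r$, where $\overline F_k(x)=\mathbb P(H_k\ge x)$ is the tail of the Gamma law and $T_k(r)=\theta\,(r^2+h^2)^{\alpha_k/2}(I_L+I_N+\sigma^2)/(PG_{dM}G_{uM})$. Likewise $S_p=\mathbb E[\overline F_K(T_K(r_x))]$, where $K$ is the random state of the intended link. 3. When $\overline F_k(x)$ is replaced by Alzer's approximation $1-(1-e^{-g_kx})^{m_k}$, the expectations in part 2 become exactly $F_k^{g}(r)$ (for all $k$ and $r$) and $F^{g}$. In this sense $(S_p|k)\approx F_k^g$ and $S_p\approx F^g$. 4. With $c=m$ denoting the coefficients $c_k=m_k$, the approximation satisfies $F_k^{m}(r)\le(S_p|k)(r)\le F_k^{g}(r)$ for all $k,r$, and $F^{m}\le S_p\le F^{g}$. In particular it is exact if $m_L=m_N=1$. -/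

import Mathlib

open MeasureTheory ProbabilityTheory
open scoped ENNReal NNReal Nat

namespace URDC

noncomputable section

/-- The propagation state of a ground-to-air link. -/
inductive Link
  | LOS
  | NLOS
  deriving DecidableEq

/-- The ground plane. -/
abbrev Plane := EuclideanSpace ℝ (Fin 2)

/-- The parameters of the device-centric uplink network. -/
structure Params where
  /-- radius of the hexagonal cells -/
  R : ℝ
  /-- altitude of the UAVs -/
  h : ℝ
  /-- environment parameters of the line-of-sight probability -/
  a : ℝ
  b : ℝ
  /-- path loss exponent of each link state -/
  pathLoss : Link → ℝ
  /-- integer Nakagami shape parameter of each link state -/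
  m : Link → ℕ
  /-- transmission power of the devices -/
  P : ℝ
  /-- noise power -/
  sigmaSq : ℝ
  /-- main and side lobe gains of the device antennas -/
  GdM : ℝ
  Gdm : ℝ
  /-- main and side lobe gains of the UAV antennas -/
  GuM : ℝ
  Gum : ℝ
  /-- main lobe beamwidths of devices and UAVs -/
  beamD : ℝ
  beamU : ℝ
  /-- slot duration and the part of it that is left for transmission -/
  Ts : ℝ
  tDC : ℝ
  /-- packet size, rate penalty of the coding scheme, bandwidth -/
  packetSize : ℝ
  zeta : ℝ
  W : ℝ
  /-- standard deviation of the horizontal offset of the served device -/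
  eta : ℝ
  R_pos : 0 < R
  h_pos : 0 < h
  a_pos : 0 < a
  pathLoss_pos : ∀ k, 0 < pathLoss k
  m_pos : ∀ k, 0 < m k
  P_pos : 0 < P
  sigmaSq_nonneg : 0 ≤ sigmaSq
  GdM_pos : 0 < GdM
  Gdm_nonneg : 0 ≤ Gdm
  GuM_pos : 0 < GuM
  Gum_nonneg : 0 ≤ Gum
  beamD_mem : beamD ∈ Set.Icc 0 (2 * Real.pi)
  beamU_mem : beamU ∈ Set.Icc 0 (2 * Real.pi)
  Ts_pos : 0 < Ts
  tDC_pos : 0 < tDC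
  packetSize_pos : 0 < packetSize
  zeta_pos : 0 < zeta
  W_pos : 0 < W
  eta_pos : 0 < eta

namespace Params

variable (prm : Params)

/-- Elevation angle, in degrees, of the UAV seen at ground distance `|r|`; it is `90` at `r = 0`. -/
def elevation (r : ℝ) : ℝ :=
  if r = 0 then 90 else 180 / Real.pi * Real.arctan |prm.h / r|

/-- Line-of-sight probability at ground distance `|r|`. -/
def pLOS (r : ℝ) : ℝ :=
  1 / (1 + prm.a * Real.exp (-prm.b * (prm.elevation r - prm.a)))

/-- Probability of the link state `k` at ground distance `|r|`. -/
def linkProb : Link → ℝ → ℝ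
  | Link.LOS, r => prm.pLOS r
  | Link.NLOS, r => 1 - prm.pLOS r

/-- The link state selected by a number `u` that is uniform on `[0, 1]`:
line-of-sight with probability `pLOS r`. -/
def linkOf (r u : ℝ) : Link := if u ≤ prm.pLOS r then Link.LOS else Link.NLOS

/-- Intensity of the interfering devices. -/
def lamDC : ℝ := prm.tDC / prm.Ts * (2 / (3 * √3 * prm.R ^ 2))

/-- SINR threshold for decoding a packet. -/
def thetaDC : ℝ := (2 : ℝ) ^ (prm.packetSize / (prm.tDC * prm.zeta * prm.W)) - 1

/-- Power attenuation over ground distance `|r|` in the link state `k`. -/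
def attenuation (k : Link) (r : ℝ) : ℝ := (r ^ 2 + prm.h ^ 2) ^ (-prm.pathLoss k / 2)

def cD : ℝ := prm.beamD / (2 * Real.pi)

def cU : ℝ := prm.beamU / (2 * Real.pi)

/-- The four possible antenna gains between an interfering device and the UAV. -/
def gain : Fin 4 → ℝ :=
  ![prm.GdM * prm.GuM, prm.GdM * prm.Gum, prm.Gdm * prm.GuM, prm.Gdm * prm.Gum]

/-- Their probabilities. -/
def gainProb : Fin 4 → ℝ :=
  ![prm.cD * prm.cU, prm.cD * (1 - prm.cU), (1 - prm.cD) * prm.cU, (1 - prm.cD) * (1 - prm.cU)]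

/-- Law of the antenna gain of an interfering device. -/
def gainLaw : Measure ℝ :=
  ∑ e : Fin 4, ENNReal.ofReal (prm.gainProb e) • Measure.dirac (prm.gain e)

/-- Law of the power fading gain in the link state `k`: Gamma with shape `m k` and mean `1`. -/
def fadingLaw (k : Link) : Measure ℝ := gammaMeasure (prm.m k) (prm.m k)

/-- Intensity measure of the interfering devices: intensity `lamDC` outside the disc of
radius `R / 2` around the UAV. -/
def interfererIntensity : Measure Plane :=
  ENNReal.ofReal prm.lamDC • volume.restrict (Metric.ball (0 : Plane) (prm.R / 2))ᶜ

end Params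

/-- Number of points of the configuration `x` in `B`, with multiplicity. -/
def pointCount {E : Type*} (x : ℕ → E) (B : Set E) : ℝ≥0∞ :=
  ∑' i, B.indicator (fun _ => (1 : ℝ≥0∞)) (x i)

/-- The points `X 0, X 1, …` form a Poisson point process with intensity measure `Λ`: counts in
sets of finite intensity are Poisson, and counts in disjoint sets are independent. -/
structure IsPoissonProcess {E Ω : Type*} [MeasurableSpace E] [MeasurableSpace Ω]
    (X : ℕ → Ω → E) (Λ : Measure E) (μ : Measure Ω) : Prop where
  measurable : ∀ i, Measurable (X i)
  count_law : ∀ B : Set E, MeasurableSet B → Λ B ≠ ∞ →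
    μ.map (fun ω => pointCount (fun i => X i ω) B) =
      (poissonMeasure (Λ B).toNNReal).map (fun n : ℕ => (n : ℝ≥0∞))
  count_indep : ∀ (n : ℕ) (B : Fin n → Set E), (∀ j, MeasurableSet (B j)) →
    (∀ j, Λ (B j) ≠ ∞) → Pairwise (fun j l => Disjoint (B j) (B l)) →
    iIndepFun (fun j ω => pointCount (fun i => X i ω) (B j)) μ

/-- A realization of the network on the probability space `(Ω, μ)`, with the UAV that serves the
typical device above the origin. -/
structure Model (prm : Params) {Ω : Type*} [MeasurableSpace Ω] (μ : Measure Ω) where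
  /-- horizontal offset of the typical device -/
  rx : Ω → ℝ
  /-- uniform variable that selects the state of the intended link -/
  U0 : Ω → ℝ
  /-- fading gain of the intended link in each state -/
  H0 : Link → Ω → ℝ
  /-- positions of the interfering devices -/
  X : ℕ → Ω → Plane
  /-- uniform variables that select the states of the interfering links -/
  U : ℕ → Ω → ℝ
  /-- fading gains of the interfering links in each state -/
  H : Link → ℕ → Ω → ℝ
  /-- antenna gains of the interfering links -/
  G : ℕ → Ω → ℝ
  measurable_rx : Measurable rx
  measurable_U0 : Measurable U0
  measurable_H0 : ∀ k, Measurable (H0 k)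
  measurable_U : ∀ i, Measurable (U i)
  measurable_H : ∀ k i, Measurable (H k i)
  measurable_G : ∀ i, Measurable (G i)
  /-- the offset, the selector and the fading gains of the typical device are independent, with
  their prescribed laws -/
  typical_law : μ.map (fun ω => (rx ω, U0 ω, H0 Link.LOS ω, H0 Link.NLOS ω)) =
    (gaussianReal 0 (Real.toNNReal (prm.eta ^ 2))).prod
      ((volume.restrict (Set.Icc (0 : ℝ) 1)).prod
        ((prm.fadingLaw Link.LOS).prod (prm.fadingLaw Link.NLOS)))
  poisson : IsPoissonProcess X prm.interfererIntensity μ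
  /-- the marks of each interfering device are independent, with their prescribed laws -/
  mark_law : ∀ i, μ.map (fun ω => (U i ω, H Link.LOS i ω, H Link.NLOS i ω, G i ω)) =
    (volume.restrict (Set.Icc (0 : ℝ) 1)).prod
      ((prm.fadingLaw Link.LOS).prod ((prm.fadingLaw Link.NLOS).prod prm.gainLaw))
  /-- the marks of different interfering devices are independent -/
  mark_indep : iIndepFun (fun i ω => (U i ω, H Link.LOS i ω, H Link.NLOS i ω, G i ω)) μ
  /-- the marks are independent of the positions -/
  position_mark_indep : IndepFun (fun ω i => X i ω)
    (fun ω i => (U i ω, H Link.LOS i ω, H Link.NLOS i ω, G i ω)) μ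
  /-- the typical device is independent of the interfering devices -/
  typical_indep : IndepFun (fun ω => (rx ω, U0 ω, H0 Link.LOS ω, H0 Link.NLOS ω))
    (fun ω => ((fun i => X i ω : ℕ → Plane),
      (fun i => (U i ω, H Link.LOS i ω, H Link.NLOS i ω, G i ω) : ℕ → ℝ × ℝ × ℝ × ℝ))) μ

/-- `exp (-x)` for `x ∈ [0, ∞]`, with `exp (-∞) = 0`. -/
def expNeg (x : ℝ≥0∞) : ℝ := if x = ∞ then 0 else Real.exp (-x.toReal)

/-! ### The success probability of the model -/

namespace Model

variable {prm : Params} {Ω : Type*} [MeasurableSpace Ω] {μ : Measure Ω} (M : Model prm μ)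

/-- State of the intended link. -/
def link0 (ω : Ω) : Link := prm.linkOf (M.rx ω) (M.U0 ω)

/-- State of the link from the `i`-th interfering device. -/
def link (i : ℕ) (ω : Ω) : Link := prm.linkOf ‖M.X i ω‖ (M.U i ω)

/-- Aggregate interference from the devices whose link is in the state `k`. -/
def interference (k : Link) (ω : Ω) : ℝ≥0∞ :=
  ∑' i, if M.link i ω = k then
    ENNReal.ofReal (prm.P * M.H k i ω * M.G i ω * prm.attenuation k ‖M.X i ω‖) else 0

/-- Interference plus noise. -/
def disturbance (ω : Ω) : ℝ≥0∞ :=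
  M.interference Link.LOS ω + M.interference Link.NLOS ω + ENNReal.ofReal prm.sigmaSq

/-- SINR when the intended link has state `k` and horizontal offset `r`. -/
def sinrAt (k : Link) (r : ℝ) (ω : Ω) : ℝ≥0∞ :=
  ENNReal.ofReal (prm.P * M.H0 k ω * prm.GdM * prm.GuM * prm.attenuation k r) / M.disturbance ω

/-- SINR of the typical device. -/
def sinr (ω : Ω) : ℝ≥0∞ := M.sinrAt (M.link0 ω) (M.rx ω) ω

/-- Packet success probability. -/
def successProb : ℝ := μ.real {ω | ENNReal.ofReal prm.thetaDC ≤ M.sinr ω}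

/-- Packet success probability for an intended link in the state `k` with offset `r`. -/
def condSuccessProb (k : Link) (r : ℝ) : ℝ :=
  μ.real {ω | ENNReal.ofReal prm.thetaDC ≤ M.sinrAt k r ω}

/-- The level that the fading gain of an intended link in the state `k` with offset `r` has to
reach for the packet to be decoded. -/
def fadingLevel (k : Link) (r : ℝ) (ω : Ω) : ℝ≥0∞ :=
  ENNReal.ofReal (prm.thetaDC * (r ^ 2 + prm.h ^ 2) ^ (prm.pathLoss k / 2) /
    (prm.P * prm.GdM * prm.GuM)) * M.disturbance ω

/-- Success probability of an intended link in the state `k` with offset `r` when the tail function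
of the fading gain is taken to be `T k`. -/
def condSuccessWithTail (T : Link → ℝ≥0∞ → ℝ) (k : Link) (r : ℝ) : ℝ :=
  ∫ ω, T k (M.fadingLevel k r ω) ∂μ

/-- Success probability of the typical device when the tail function of the fading gain of a link
in the state `k` is taken to be `T k`. -/
def successWithTail (T : Link → ℝ≥0∞ → ℝ) : ℝ :=
  ∫ ω, T (M.link0 ω) (M.fadingLevel (M.link0 ω) (M.rx ω) ω) ∂μ

end Model

/-! ### Tails of the fading gain and the closed form -/

namespace Params

variable (prm : Params)

/-- Exact tail of the fading gain. -/
def gammaTail (k : Link) (x : ℝ≥0∞) : ℝ := (prm.fadingLaw k).real {y | x ≤ ENNReal.ofReal y}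

/-- The tail `1 - (1 - exp (-c k * x)) ^ m k`. -/
def alzerTail (c : Link → ℝ) (k : Link) (x : ℝ≥0∞) : ℝ :=
  1 - (1 - expNeg (ENNReal.ofReal (c k) * x)) ^ prm.m k

/-- Alzer's coefficient `m (m!) ^ (-1 / m)`. -/
def g (k : Link) : ℝ := prm.m k * ((prm.m k)! : ℝ) ^ (-1 / (prm.m k : ℝ))

/-- The exponent of the Laplace transform of the interference from links in the state `k`. -/
def laplaceExponent (k : Link) (s : ℝ) : ℝ≥0∞ :=
  ENNReal.ofReal (2 * Real.pi * prm.lamDC) * ∑ e : Fin 4, ENNReal.ofReal (prm.gainProb e) *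
    ∫⁻ r in Set.Ioi (prm.R / 2), ENNReal.ofReal (prm.linkProb k r *
      (1 - (1 + s * prm.P * prm.gain e * prm.attenuation k r / prm.m k) ^ (-(prm.m k : ℤ))) * r)

/-- Closed form of the Laplace transform of the interference from links in the state `k`. -/
def laplace (k : Link) (s : ℝ) : ℝ := expNeg (prm.laplaceExponent k s)

/-- Argument of the Laplace transforms in the `n`-th term of the closed form. -/
def arg (c : Link → ℝ) (k : Link) (r : ℝ) (n : ℕ) : ℝ :=
  c k * n * prm.thetaDC * (r ^ 2 + prm.h ^ 2) ^ (prm.pathLoss k / 2) / (prm.P * prm.GdM * prm.GuM)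

/-- Closed form of the conditional success probability, with coefficients `c`. -/
def condFormula (c : Link → ℝ) (k : Link) (r : ℝ) : ℝ :=
  ∑ n ∈ Finset.Icc 1 (prm.m k), (-1 : ℝ) ^ (n + 1) * ((prm.m k).choose n : ℝ) *
    Real.exp (-(prm.arg c k r n * prm.sigmaSq)) *
    prm.laplace Link.LOS (prm.arg c k r n) * prm.laplace Link.NLOS (prm.arg c k r n)

/-- Mixture of two conditional terms by the state of the intended link, times the density of the
Gaussian offset. -/
def mixture (f : Link → ℝ → ℝ) (r : ℝ) : ℝ :=
  (f Link.LOS r * prm.pLOS r + f Link.NLOS r * (1 - prm.pLOS r)) *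
    (1 / √(2 * Real.pi * prm.eta ^ 2) * Real.exp (-r ^ 2 / (2 * prm.eta ^ 2)))

/-- Closed form of the packet success probability, with coefficients `c`. -/
def successFormula (c : Link → ℝ) : ℝ := ∫ r, prm.mixture (prm.condFormula c) r

end Params

end

end URDC

open Filter Topology

namespace URDC

/-! ### The function `expNeg` -/

/-! Decoding is a threshold event. For a fixed state and offset of the intended link, the SINR
reaches the threshold exactly when the fading gain reaches a constant times the disturbance
(`le_div_iff_levelCoeff_mul_le`, for positive gain, hence almost surely). The gain is independent of
everything else in this inequality, so integrating it out leaves the mean of its tail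
(`measureReal_le_fading`). Integrating next over the disturbance, the uniform selector and the
offset gives the Gaussian mixture.

By the binomial theorem Alzer's tail is an alternating sum of exponentials, so its mean reduces to
Laplace transforms of the disturbance. These come from the Laplace functional of a Poisson process,
derived from the laws of the counts: Poisson generating function, simple functions, monotone limits.
Independent marks are averaged at each point, and the average is again of the form `expNeg (g x)`,
which reduces the marked process to the unmarked one. Since a device is in exactly one link state,
the averaged `1 - expNeg` is a sum of one rate per state. The exponents therefore add and the joint
transform of the two interferences factors; polar coordinates turn the planar integrals into the
radial ones.

The bounds hold already for the tails. The difference of the two distribution functions vanishes at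
`0` and at infinity, and once its derivative is negative it stays nonpositive, so the difference is
nonnegative. This sign pattern follows from power means for the coefficient `g` and from
monotonicity of `expMean` for the coefficient `m`. -/

lemma expNeg_eq_toReal_exp (x : ℝ≥0∞) : expNeg x = (EReal.exp (-(x : EReal))).toReal := by
  unfold expNeg
  split_ifs with h
  · simp [h]
  · lift x to ℝ≥0 using h
    have : (-((x : ℝ≥0∞) : EReal)) = ((-(x : ℝ) : ℝ) : EReal) := rfl
    rw [this, EReal.exp_coe]
    simp [ENNReal.toReal_ofReal (Real.exp_nonneg _)]

@[simp] lemma expNeg_top : expNeg ∞ = 0 := by simp [expNeg]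

@[simp] lemma expNeg_zero : expNeg 0 = 1 := by simp [expNeg]

lemma expNeg_nonneg (x : ℝ≥0∞) : 0 ≤ expNeg x := by
  unfold expNeg; split_ifs <;> positivity

lemma expNeg_ofReal {x : ℝ} (hx : 0 ≤ x) : expNeg (ENNReal.ofReal x) = Real.exp (-x) := by
  simp [expNeg, ENNReal.toReal_ofReal hx]

lemma expNeg_le_one (x : ℝ≥0∞) : expNeg x ≤ 1 := by
  unfold expNeg; split_ifs <;> simp

lemma abs_expNeg_le_one (x : ℝ≥0∞) : |expNeg x| ≤ 1 := by
  rw [abs_of_nonneg (expNeg_nonneg x)]; exact expNeg_le_one x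

lemma expNeg_add (x y : ℝ≥0∞) : expNeg (x + y) = expNeg x * expNeg y := by
  by_cases hx : x = ∞
  · simp [hx]
  by_cases hy : y = ∞
  · simp [hy]
  simp only [expNeg, ENNReal.add_eq_top, hx, hy, or_self, if_false, ← Real.exp_add,
    ENNReal.toReal_add hx hy]
  congr 1; ring

lemma expNeg_sum {ι : Type*} (s : Finset ι) (f : ι → ℝ≥0∞) :
    expNeg (∑ i ∈ s, f i) = ∏ i ∈ s, expNeg (f i) := by
  classical
  induction s using Finset.induction_on with
  | empty => simp
  | insert a s ha ih => rw [Finset.sum_insert ha, Finset.prod_insert ha, expNeg_add, ih]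

lemma expNeg_natCast_mul (n : ℕ) (x : ℝ≥0∞) : expNeg (n * x) = expNeg x ^ n := by
  induction n with
  | zero => simp
  | succ n ih => rw [Nat.cast_succ, add_mul, one_mul, expNeg_add, ih, pow_succ]

/-- Continuity includes the point `∞`, so limits may pass through divergent sums and integrals. It
is inherited from `EReal.exp`, whose values here are at most `1`, where `toReal` is continuous. -/
lemma continuous_expNeg : Continuous expNeg := by
  have h : expNeg = fun x : ℝ≥0∞ => (EReal.exp (-(x : EReal))).toReal := funext expNeg_eq_toReal_exp
  rw [h, continuous_iff_continuousAt]
  intro x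
  have hc : Continuous fun x : ℝ≥0∞ => EReal.exp (-(x : EReal)) := 
    ENNReal.continuous_exp.comp (continuous_neg.comp continuous_coe_ennreal_ereal)
  refine (ENNReal.tendsto_toReal ?_).comp hc.continuousAt
  refine ne_of_lt (lt_of_le_of_lt (b := 1) ?_ ENNReal.one_lt_top)
  rw [← EReal.exp_zero]
  exact EReal.exp_monotone (by simpa using EReal.coe_ennreal_nonneg x)

lemma measurable_expNeg : Measurable expNeg := continuous_expNeg.measurable

lemma antitone_expNeg : Antitone expNeg := by
  intro x y hxy
  obtain ⟨z, rfl⟩ := exists_add_of_le hxy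
  rw [expNeg_add]
  exact mul_le_of_le_one_right (expNeg_nonneg x) (expNeg_le_one z)

lemma integrable_expNeg {Ω : Type*} [MeasurableSpace Ω] {μ : Measure Ω} [IsFiniteMeasure μ]
    {f : Ω → ℝ≥0∞} (hf : Measurable f) : Integrable (fun ω => expNeg (f ω)) μ :=
  Integrable.of_bound (measurable_expNeg.comp hf).aestronglyMeasurable 1
    (ae_of_all _ fun ω => by simpa using abs_expNeg_le_one (f ω))

lemma integral_expNeg_mem_Icc {Ω : Type*} [MeasurableSpace Ω] {μ : Measure Ω}
    [IsProbabilityMeasure μ] (f : Ω → ℝ≥0∞) (hf : Measurable f) :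
    ∫ ω, expNeg (f ω) ∂μ ∈ Set.Icc (0 : ℝ) 1 := by
  refine ⟨integral_nonneg fun ω => expNeg_nonneg _, ?_⟩
  simpa using integral_mono (integrable_expNeg hf) (integrable_const (μ := μ) (1 : ℝ))
    fun ω => expNeg_le_one (f ω)

/-- Dominated convergence for Laplace transforms. -/
lemma tendsto_integral_expNeg {Ω : Type*} [MeasurableSpace Ω] {μ : Measure Ω} [IsFiniteMeasure μ]
    {f : ℕ → Ω → ℝ≥0∞} {g : Ω → ℝ≥0∞} (hf : ∀ n, Measurable (f n))
    (h : ∀ ω, Tendsto (fun n => f n ω) atTop (𝓝 (g ω))) :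
    Tendsto (fun n => ∫ ω, expNeg (f n ω) ∂μ) atTop (𝓝 (∫ ω, expNeg (g ω) ∂μ)) :=
  tendsto_integral_of_dominated_convergence (fun _ => 1)
    (fun n => (measurable_expNeg.comp (hf n)).aestronglyMeasurable) (integrable_const _)
    (fun n => ae_of_all _ fun ω => by simpa using abs_expNeg_le_one _)
    (ae_of_all _ fun ω => (continuous_expNeg.tendsto _).comp (h ω))

/-! ### The Laplace functional of a Poisson process -/

/-- The probability generating function of the Poisson law, from the exponential series. -/
lemma integral_pow_poissonMeasure (r : ℝ≥0) (q : ℝ) :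
    ∫ n, q ^ n ∂(poissonMeasure r) = Real.exp (-(r * (1 - q))) := by
  rw [integral_poissonMeasure]
  have h := (NormedSpace.expSeries_div_hasSum_exp ((r : ℝ) * q)).mul_left (Real.exp (-r))
  have : ∀ n : ℕ, (Real.exp (-r) * (r : ℝ) ^ n / (n)!) • q ^ n =
      Real.exp (-r) * (((r : ℝ) * q) ^ n / (n)!) := fun n => by
    rw [smul_eq_mul, mul_pow]; ring
  simp_rw [this]
  rw [h.tsum_eq, ← Real.exp_eq_exp_ℝ, ← Real.exp_add]
  congr 1; ring

section Poisson

variable {E Ω : Type*} [MeasurableSpace E] [MeasurableSpace Ω] {X : ℕ → Ω → E} {Λ : Measure E}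
  {μ : Measure Ω}

lemma IsPoissonProcess.measurable_pointCount (hX : IsPoissonProcess X Λ μ) {B : Set E}
    (hB : MeasurableSet B) : Measurable fun ω => pointCount (fun i => X i ω) B :=
  Measurable.tsum fun i =>
    (measurable_const.indicator hB).comp (hX.measurable i)

lemma IsPoissonProcess.integral_expNeg_pointCount (hX : IsPoissonProcess X Λ μ) {B : Set E}
    (hB : MeasurableSet B) (hΛ : Λ B ≠ ∞) (c : ℝ≥0∞) :
    ∫ ω, expNeg (pointCount (fun i => X i ω) B * c) ∂μ =
      expNeg (ENNReal.ofReal (1 - expNeg c) * Λ B) := by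
  have hm : Measurable fun x : ℝ≥0∞ => expNeg (x * c) :=
    measurable_expNeg.comp (measurable_id.mul_const c)
  rw [← integral_map (f := fun x => expNeg (x * c)) (hX.measurable_pointCount hB).aemeasurable
    hm.aestronglyMeasurable, hX.count_law B hB hΛ, integral_map .of_discrete
    hm.aestronglyMeasurable]
  simp_rw [expNeg_natCast_mul]
  have h0 : 0 ≤ 1 - expNeg c := sub_nonneg.2 (expNeg_le_one c)
  rw [integral_pow_poissonMeasure, ← ENNReal.ofReal_toReal hΛ, ← ENNReal.ofReal_mul h0,
    expNeg_ofReal (by positivity), ENNReal.ofReal_toReal hΛ, mul_comm]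
  rfl

/-- Counts in disjoint sets are independent and `expNeg` turns sums into products, so the one-set
formula multiplies. -/
lemma IsPoissonProcess.integral_expNeg_sum_pointCount
    (hX : IsPoissonProcess X Λ μ) {n : ℕ} (B : Fin n → Set E) (c : Fin n → ℝ≥0∞)
    (hB : ∀ j, MeasurableSet (B j)) (hΛ : ∀ j, Λ (B j) ≠ ∞)
    (hd : Pairwise fun j l => Disjoint (B j) (B l)) :
    ∫ ω, expNeg (∑ j, pointCount (fun i => X i ω) (B j) * c j) ∂μ =
      expNeg (∑ j, ENNReal.ofReal (1 - expNeg (c j)) * Λ (B j)) := by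
  simp_rw [expNeg_sum]
  have hm : ∀ j, Measurable fun x : ℝ≥0∞ => expNeg (x * c j) := fun j =>
    measurable_expNeg.comp (measurable_id.mul_const _)
  have := ((hX.count_indep n B hB hΛ hd).comp (fun j x => expNeg (x * c j))
    hm).integral_fun_prod_eq_prod_integral
    (fun j => ((hm j).comp (hX.measurable_pointCount (hB j))).aestronglyMeasurable)
  simp only [Function.comp_apply] at this
  rw [this]
  exact Finset.prod_congr rfl fun j _ => hX.integral_expNeg_pointCount (hB j) (hΛ j) (c j)

lemma IsPoissonProcess.integral_expNeg_simpleFunc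
    (hX : IsPoissonProcess X Λ μ) (s : SimpleFunc E ℝ≥0∞)
    (hs : Λ (Function.support s) ≠ ∞) :
    ∫ ω, expNeg (∑' i, s (X i ω)) ∂μ =
      expNeg (∫⁻ x, ENNReal.ofReal (1 - expNeg (s x)) ∂Λ) := by
  classical
  -- The value `0` is dropped because its level set may have infinite intensity, where the law of
  -- the count is not prescribed.
  set F : Finset ℝ≥0∞ := s.range.filter (· ≠ 0) with hF
  let e := F.equivFin.symm
  have key : ∀ ψ : ℝ≥0∞ → ℝ≥0∞, ∑ j, ψ (e j : ℝ≥0∞) = ∑ c ∈ F, ψ c := fun ψ => by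
    rw [← Finset.sum_coe_sort F, ← e.sum_comp]
  have hcount : ∀ x : ℕ → E, ∑' i, s (x i) =
      ∑ j, pointCount x (s ⁻¹' {(e j : ℝ≥0∞)}) * (e j : ℝ≥0∞) := fun x => by
    rw [key fun c => pointCount x (s ⁻¹' {c}) * c]
    simp_rw [pointCount, ← ENNReal.tsum_mul_right]
    rw [← Summable.tsum_finsetSum fun _ _ => ENNReal.summable]
    congr 1; ext i
    simp only [Set.indicator, Set.mem_preimage, Set.mem_singleton_iff, ite_mul, one_mul, zero_mul]
    rw [Finset.sum_ite_eq]
    split_ifs with h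
    · rfl
    · by_contra h'
      exact h (by simp [hF, h'])
  have hint : ∫⁻ x, ENNReal.ofReal (1 - expNeg (s x)) ∂Λ =
      ∑ j, ENNReal.ofReal (1 - expNeg (e j : ℝ≥0∞)) * Λ (s ⁻¹' {(e j : ℝ≥0∞)}) := by
    rw [key fun c => ENNReal.ofReal (1 - expNeg c) * Λ (s ⁻¹' {c})]
    have := (s.map fun c => ENNReal.ofReal (1 - expNeg c)).lintegral_eq_lintegral Λ
    simp only [SimpleFunc.map_apply] at this
    rw [this, SimpleFunc.map_lintegral, hF, Finset.sum_filter]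
    refine Finset.sum_congr rfl fun c _ => ?_
    by_cases hc : c = 0 <;> simp [hc]
  simp_rw [hcount]
  rw [hint]
  refine hX.integral_expNeg_sum_pointCount _ _ (fun j => s.measurableSet_preimage _) (fun j => ?_) ?_
  · refine ne_top_of_le_ne_top hs (measure_mono fun x hx => ?_)
    have : (e j : ℝ≥0∞) ≠ 0 := (Finset.mem_filter.1 (e j).2).2
    simpa [show s x = e j from hx] using this
  · intro j l hjl
    refine Disjoint.preimage _ (Set.disjoint_singleton.2 fun h => hjl ?_)
    exact e.injective (Subtype.ext h)

/-- The Laplace functional of a Poisson process. -/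
theorem IsPoissonProcess.integral_expNeg_tsum [IsFiniteMeasure μ] [SigmaFinite Λ]
    (hX : IsPoissonProcess X Λ μ) {g : E → ℝ≥0∞} (hg : Measurable g) :
    ∫ ω, expNeg (∑' i, g (X i ω)) ∂μ =
      expNeg (∫⁻ x, ENNReal.ofReal (1 - expNeg (g x)) ∂Λ) := by
  -- Restricting to spanning sets gives each approximation a support of finite intensity and keeps
  -- the sequence monotone.
  let s : ℕ → SimpleFunc E ℝ≥0∞ := fun n =>
    (SimpleFunc.eapprox g n).restrict (spanningSets Λ n)
  have happ : ∀ n x, s n x = (spanningSets Λ n).indicator (SimpleFunc.eapprox g n) x := fun n x =>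
    SimpleFunc.restrict_apply _ (measurableSet_spanningSets Λ n) x
  have hmono : ∀ x, Monotone fun n => s n x := fun x n m hnm => by
    simp only [happ]
    refine (Set.indicator_le_indicator_of_subset (monotone_spanningSets Λ hnm)
      (fun _ => bot_le) x).trans ?_
    exact Set.indicator_le_indicator (SimpleFunc.monotone_eapprox g hnm x)
  have hlim : ∀ x, Tendsto (fun n => s n x) atTop (𝓝 (g x)) := fun x => by
    refine (SimpleFunc.tendsto_eapprox hg x).congr' ?_
    filter_upwards [eventually_ge_atTop (spanningSetsIndex Λ x)] with n hn
    rw [happ, Set.indicator_of_mem]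
    exact mem_spanningSets_of_index_le Λ x hn
  have hs : ∀ n, Λ (Function.support (s n)) ≠ ∞ := fun n => by
    refine ne_top_of_le_ne_top (measure_spanningSets_lt_top Λ n).ne (measure_mono fun x hx => ?_)
    by_contra h
    exact hx (by simp [happ, h])
  have hsum : ∀ ω, Tendsto (fun n => ∑' i, s n (X i ω)) atTop (𝓝 (∑' i, g (X i ω))) := fun ω => by
    -- Monotone convergence for the sum over the points, read as an integral against counting
    -- measure.
    have := lintegral_tendsto_of_tendsto_of_monotone (μ := Measure.count)
      (f := fun n i => s n (X i ω)) (F := fun i => g (X i ω)) (fun n => .of_discrete)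
      (ae_of_all _ fun i => hmono _) (ae_of_all _ fun i => hlim _)
    simpa only [lintegral_count] using this
  have h1 := tendsto_integral_expNeg (μ := μ) (fun n => Measurable.tsum fun i =>
    (s n).measurable.comp (hX.measurable i)) hsum
  replace h1 := h1.congr fun n => hX.integral_expNeg_simpleFunc (s n) (hs n)
  refine tendsto_nhds_unique h1 ((continuous_expNeg.tendsto _).comp ?_)
  refine lintegral_tendsto_of_tendsto_of_monotone (fun n => ?_) (ae_of_all _ fun x => ?_)
    (ae_of_all _ fun x => ?_)
  · exact ((measurable_const.sub (measurable_expNeg.comp (s n).measurable)).ennreal_ofReal).aemeasurable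
  · exact fun n m hnm => ENNReal.ofReal_le_ofReal (sub_le_sub_left (antitone_expNeg (hmono x hnm)) _)
  · exact (ENNReal.continuous_ofReal.tendsto _).comp
      (((continuous_expNeg.tendsto _).comp (hlim x)).const_sub 1)

end Poisson

/-! ### The Laplace functional of an independently marked Poisson process -/

/-- The inverse of `expNeg` on `[0, 1]`. -/
noncomputable def negLog (q : ℝ) : ℝ≥0∞ := if q = 0 then ∞ else ENNReal.ofReal (-Real.log q)

lemma measurable_negLog : Measurable negLog :=
  Measurable.ite (measurableSet_singleton 0) measurable_const
    (Real.measurable_log.neg.ennreal_ofReal)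

lemma expNeg_negLog {q : ℝ} (hq : q ∈ Set.Icc (0 : ℝ) 1) : expNeg (negLog q) = q := by
  unfold negLog
  split_ifs with h
  · simp [h]
  · rw [expNeg_ofReal (neg_nonneg.2 (Real.log_nonpos hq.1 hq.2)), neg_neg,
      Real.exp_log (lt_of_le_of_ne hq.1 (Ne.symm h))]

lemma integral_expNeg_map {E Ω : Type*} [MeasurableSpace E] [MeasurableSpace Ω] {μ : Measure Ω}
    {T : Ω → E} (hT : Measurable T) {g : E → ℝ≥0∞} (hg : Measurable g) :
    ∫ x, expNeg (g x) ∂(μ.map T) = ∫ ω, expNeg (g (T ω)) ∂μ :=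
  integral_map hT.aemeasurable (measurable_expNeg.comp hg).aestronglyMeasurable

section Marked

variable {E S Ω : Type*} [MeasurableSpace E] [MeasurableSpace S] [MeasurableSpace Ω]
  {X : ℕ → Ω → E} {Y : ℕ → Ω → S} {μ : Measure Ω} [IsProbabilityMeasure μ] {ρ : Measure S}

/-- With the positions frozen, which independence from the marks permits, the factors depend on
different marks and their means multiply. Finitely many factors suffice, since the full sum is
recovered as a limit. -/
lemma integral_prod_expNeg_of_indepFun (hX : ∀ i, Measurable (X i)) (hY : ∀ i, Measurable (Y i))
    (hρ : ∀ i, μ.map (Y i) = ρ) (hind : iIndepFun Y μ)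
    (hXY : IndepFun (fun ω i => X i ω) (fun ω i => Y i ω) μ) {f : E → S → ℝ≥0∞}
    (hf : Measurable (Function.uncurry f)) (n : ℕ) :
    ∫ ω, ∏ i ∈ Finset.range n, expNeg (f (X i ω) (Y i ω)) ∂μ =
      ∫ ω, ∏ i ∈ Finset.range n, ∫ y, expNeg (f (X i ω) y) ∂ρ ∂μ := by
  have hXm : Measurable fun ω i => X i ω := measurable_pi_lambda _ hX
  have hYm : Measurable fun ω i => Y i ω := measurable_pi_lambda _ hY
  have : IsProbabilityMeasure ρ := hρ 0 ▸ Measure.isProbabilityMeasure_map (hY 0).aemeasurable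
  have : IsProbabilityMeasure (μ.map fun ω i => X i ω) :=
    Measure.isProbabilityMeasure_map hXm.aemeasurable
  have : IsProbabilityMeasure (μ.map fun ω i => Y i ω) :=
    Measure.isProbabilityMeasure_map hYm.aemeasurable
  have hF : Measurable fun p : (ℕ → E) × (ℕ → S) => ∑ i ∈ Finset.range n, f (p.1 i) (p.2 i) :=
    Finset.measurable_sum _ fun i _ => by
      have : Measurable fun p : (ℕ → E) × (ℕ → S) => (p.1 i, p.2 i) := by fun_prop
      exact hf.comp this
  have hφ : Measurable fun x : E => ∫ y, expNeg (f x y) ∂ρ :=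
    (measurable_expNeg.comp hf).stronglyMeasurable.integral_prod_right'.measurable
  have hjoint := (indepFun_iff_map_prod_eq_prod_map_map hXm.aemeasurable hYm.aemeasurable).1 hXY
  have h1 : ∫ ω, ∏ i ∈ Finset.range n, expNeg (f (X i ω) (Y i ω)) ∂μ =
      ∫ p, expNeg (∑ i ∈ Finset.range n, f (p.1 i) (p.2 i))
        ∂((μ.map fun ω i => X i ω).prod (μ.map fun ω i => Y i ω)) := by
    rw [← hjoint, integral_expNeg_map (hXm.prodMk hYm) hF]
    simp_rw [expNeg_sum]
  rw [h1, integral_prod _ (integrable_expNeg hF)]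
  have h2 : ∀ x : ℕ → E, ∫ y, expNeg (∑ i ∈ Finset.range n, f (x i) (y i))
      ∂(μ.map fun ω i => Y i ω) = ∏ i ∈ Finset.range n, ∫ y, expNeg (f (x i) y) ∂ρ := fun x => by
    have hx : ∀ i, Measurable fun y => expNeg (f (x i) y) := fun i =>
      measurable_expNeg.comp (hf.comp measurable_prodMk_left)
    have hFx : Measurable fun y : ℕ → S => ∑ i ∈ Finset.range n, f (x i) (y i) :=
      hF.comp measurable_prodMk_left
    rw [integral_expNeg_map hYm hFx]
    simp_rw [expNeg_sum, Finset.prod_range]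
    have := ((hind.precomp (g := ((↑) : Fin n → ℕ)) Fin.val_injective).comp
      (fun i y => expNeg (f (x i) y)) (fun i => hx i)).integral_fun_prod_eq_prod_integral
      (fun i => ((hx i).comp (hY i)).aestronglyMeasurable)
    simp only [Function.comp_apply] at this
    rw [this]
    refine Finset.prod_congr rfl fun i _ => ?_
    rw [← hρ i, integral_map (hY i).aemeasurable (hx i).aestronglyMeasurable]
  simp_rw [h2]
  rw [integral_map hXm.aemeasurable]
  exact (Finset.measurable_prod _ fun i _ =>
    hφ.comp (measurable_pi_apply i)).aestronglyMeasurable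

/-- The Laplace functional of an independently marked Poisson process. -/
theorem IsPoissonProcess.integral_expNeg_tsum_marked {Λ : Measure E} [SigmaFinite Λ]
    (hX : IsPoissonProcess X Λ μ) (hY : ∀ i, Measurable (Y i))
    (hρ : ∀ i, μ.map (Y i) = ρ) (hind : iIndepFun Y μ)
    (hXY : IndepFun (fun ω i => X i ω) (fun ω i => Y i ω) μ) {f : E → S → ℝ≥0∞}
    (hf : Measurable (Function.uncurry f)) :
    ∫ ω, expNeg (∑' i, f (X i ω) (Y i ω)) ∂μ =
      expNeg (∫⁻ x, ENNReal.ofReal (1 - ∫ y, expNeg (f x y) ∂ρ) ∂Λ) := by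
  have : IsProbabilityMeasure ρ := hρ 0 ▸ Measure.isProbabilityMeasure_map (hY 0).aemeasurable
  have hφ : Measurable fun x : E => ∫ y, expNeg (f x y) ∂ρ :=
    (measurable_expNeg.comp hf).stronglyMeasurable.integral_prod_right'.measurable
  -- Averaging over the mark gives a number in `[0, 1]`, so it is `expNeg` of some `g x`; the value
  -- `∞` covers a vanishing average. Marked and unmarked partial sums then have the same transform
  -- for every `n`.
  set g : E → ℝ≥0∞ := fun x => negLog (∫ y, expNeg (f x y) ∂ρ) with hg
  have hgm : Measurable g := measurable_negLog.comp hφ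
  have hgφ : ∀ x, expNeg (g x) = ∫ y, expNeg (f x y) ∂ρ := fun x =>
    expNeg_negLog (integral_expNeg_mem_Icc _ (hf.comp measurable_prodMk_left))
  have hfm : ∀ i, Measurable fun ω => f (X i ω) (Y i ω) := fun i =>
    hf.comp ((hX.measurable i).prodMk (hY i))
  have h1 := tendsto_integral_expNeg (μ := μ)
    (f := fun n ω => ∑ i ∈ Finset.range n, f (X i ω) (Y i ω))
    (fun n => Finset.measurable_sum _ fun i _ => hfm i) fun ω => ENNReal.tendsto_nat_tsum _
  have h2 := tendsto_integral_expNeg (μ := μ) (f := fun n ω => ∑ i ∈ Finset.range n, g (X i ω))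
    (fun n => Finset.measurable_sum _ fun i _ => hgm.comp (hX.measurable i))
    fun ω => ENNReal.tendsto_nat_tsum _
  simp_rw [← hgφ]
  rw [← hX.integral_expNeg_tsum hgm]
  refine tendsto_nhds_unique h1 (h2.congr fun n => ?_)
  simp_rw [expNeg_sum, hgφ]
  exact (integral_prod_expNeg_of_indepFun hX.measurable hY hρ hind hXY hf n).symm

end Marked

/-! ### Radial functions in the plane -/

open Measure in
-- Polar coordinates: Haar measure off the origin is the product of the sphere measure and `r ^ (d -
-- 1) dr`, and a radial function ignores the sphere factor.
lemma lintegral_fun_norm_addHaar {E : Type*} [NormedAddCommGroup E] [NormedSpace ℝ E]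
    [FiniteDimensional ℝ E] [Nontrivial E] [MeasurableSpace E] [BorelSpace E] (μ : Measure E)
    [μ.IsAddHaarMeasure] {f : ℝ → ℝ≥0∞} (hf : Measurable f) :
    ∫⁻ x, f ‖x‖ ∂μ = Module.finrank ℝ E * μ (Metric.ball 0 1) *
      ∫⁻ r in Set.Ioi (0 : ℝ), ENNReal.ofReal (r ^ (Module.finrank ℝ E - 1)) * f r := by
  have hsub : Measurable fun r : Set.Ioi (0 : ℝ) => f r := hf.comp measurable_subtype_coe
  have hsnd : Measurable fun p : Metric.sphere (0 : E) 1 × Set.Ioi (0 : ℝ) => f p.2 :=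
    hsub.comp measurable_snd
  calc ∫⁻ x, f ‖x‖ ∂μ = ∫⁻ x : ({(0)}ᶜ : Set E), f ‖x.1‖ ∂(μ.comap (↑)) := by
        rw [lintegral_subtype_comap (measurableSet_singleton _).compl fun x => f ‖x‖,
          restrict_compl_singleton]
    _ = ∫⁻ p, f p.2 ∂(μ.toSphere.prod (.volumeIoiPow (Module.finrank ℝ E - 1))) := by
        rw [← μ.measurePreserving_homeomorphUnitSphereProd.lintegral_comp hsnd]
        simp
    _ = μ.toSphere Set.univ *
          ∫⁻ r : Set.Ioi (0 : ℝ), f r ∂(.volumeIoiPow (Module.finrank ℝ E - 1)) := by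
        rw [lintegral_prod _ hsnd.aemeasurable]
        simp only [lintegral_const, mul_comm]
    _ = _ := by
        rw [toSphere_apply_univ, volumeIoiPow, lintegral_withDensity_eq_lintegral_mul _
          (by fun_prop) hsub, ← lintegral_subtype_comap measurableSet_Ioi]
        rfl

lemma setLIntegral_compl_ball_fun_norm {f : ℝ → ℝ≥0∞} (hf : Measurable f) {ρ : ℝ} (hρ : 0 ≤ ρ) :
    ∫⁻ x in (Metric.ball (0 : Plane) ρ)ᶜ, f ‖x‖ =
      ENNReal.ofReal (2 * Real.pi) * ∫⁻ r in Set.Ioi ρ, f r * ENNReal.ofReal r := by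
  rw [← lintegral_indicator measurableSet_ball.compl]
  have h : ∀ x : Plane, (Metric.ball (0 : Plane) ρ)ᶜ.indicator (fun x => f ‖x‖) x =
      (Set.Ici ρ).indicator f ‖x‖ := fun x => by simp [Set.indicator]
  simp_rw [h]
  rw [lintegral_fun_norm_addHaar volume (hf.indicator measurableSet_Ici),
    EuclideanSpace.volume_ball_fin_two, finrank_euclideanSpace_fin]
  congr 1
  -- The dimension `2` times the area `π` of the unit disc.
  · rw [ENNReal.ofReal_mul zero_le_two]
    simp [ENNReal.ofReal, Real.toNNReal_of_nonneg Real.pi_pos.le]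
  · have : ∀ r : ℝ, ENNReal.ofReal (r ^ (2 - 1)) * (Set.Ici ρ).indicator f r =
        (Set.Ici ρ).indicator (fun r => f r * ENNReal.ofReal r) r := fun r => by
      by_cases hr : r ∈ Set.Ici ρ <;> simp [hr, mul_comm]
    simp_rw [this]
    rw [setLIntegral_indicator measurableSet_Ici]
    refine setLIntegral_congr ?_
    have h0 : (Set.Ici ρ ∩ Set.Ioi 0 : Set ℝ) =ᵐ[volume] (Set.Ioi ρ ∩ Set.Ioi 0 : Set ℝ) :=
      Ioi_ae_eq_Ici.symm.inter (ae_eq_refl _)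
    rwa [Set.inter_eq_left.2 (Set.Ioi_subset_Ioi hρ)] at h0

/-! ### The Laplace transform of the Gamma law -/

lemma integral_gammaPDFReal {a r : ℝ} (ha : 0 < a) (hr : 0 < r) :
    ∫ x, gammaPDFReal a r x = 1 := by
  rw [integral_eq_lintegral_of_nonneg_ae (ae_of_all _ (gammaPDFReal_nonneg ha hr))
    (measurable_gammaPDFReal a r).aestronglyMeasurable]
  simpa [gammaPDF] using congrArg ENNReal.toReal (lintegral_gammaPDF_eq_one ha hr)

lemma integral_gammaMeasure {a r : ℝ} (ha : 0 < a) (hr : 0 < r) (f : ℝ → ℝ) :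
    ∫ x, f x ∂(gammaMeasure a r) = ∫ x, gammaPDFReal a r x * f x := by
  have hm : Measurable (gammaPDF a r) := (measurable_gammaPDFReal a r).ennreal_ofReal
  rw [gammaMeasure, integral_withDensity_eq_integral_toReal_smul hm (ae_of_all _ fun x => ENNReal.ofReal_lt_top)]
  simp_rw [gammaPDF, ENNReal.toReal_ofReal (gammaPDFReal_nonneg ha hr _), smul_eq_mul]

lemma integral_expNeg_gammaMeasure {a r t : ℝ} (ha : 0 < a) (hr : 0 < r) (ht : 0 ≤ t) :
    ∫ x, expNeg (ENNReal.ofReal (t * x)) ∂(gammaMeasure a r) = (1 + t / r) ^ (-a) := by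
  rw [integral_gammaMeasure ha hr]
  have hrt : 0 < r + t := by positivity
  -- Exponential tilting: multiplying by `exp (-t x)` changes the rate from `r` to `r + t`, up to
  -- the ratio of the normalizing constants.
  have h : ∀ x, gammaPDFReal a r x * expNeg (ENNReal.ofReal (t * x)) =
      (r / (r + t)) ^ a * gammaPDFReal a (r + t) x := fun x => by
    unfold gammaPDFReal
    split_ifs with hx
    · rw [expNeg_ofReal (by positivity), Real.div_rpow hr.le hrt.le]
      have h1 : Real.exp (-((r + t) * x)) = Real.exp (-(r * x)) * Real.exp (-(t * x)) := by
        rw [← Real.exp_add]; congr 1; ring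
      have h2 : (r + t) ^ a ≠ 0 := (Real.rpow_pos_of_pos hrt a).ne'
      rw [h1]
      field_simp
    · simp
  simp_rw [h]
  rw [integral_const_mul, integral_gammaPDFReal ha hrt, mul_one, Real.rpow_neg (by positivity),
    ← Real.inv_rpow (by positivity)]
  congr 1
  field_simp

/-! ### Link states, antenna gains and the thinning rate -/

namespace Params

variable (prm : Params)

lemma measurable_elevation : Measurable prm.elevation := by
  unfold elevation
  exact Measurable.ite (measurableSet_singleton 0) measurable_const
    ((Real.measurable_arctan.comp (by fun_prop)).const_mul _)

lemma measurable_pLOS : Measurable prm.pLOS := by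
  unfold pLOS
  have := prm.measurable_elevation
  fun_prop

lemma pLOS_mem_Icc (r : ℝ) : prm.pLOS r ∈ Set.Icc (0 : ℝ) 1 := by
  have ha := prm.a_pos
  unfold pLOS
  refine ⟨by positivity, ?_⟩
  rw [div_le_one (by positivity)]
  have : 0 < prm.a * Real.exp (-prm.b * (prm.elevation r - prm.a)) := by positivity
  linarith

lemma measurable_linkProb (k : Link) : Measurable (prm.linkProb k) := by
  cases k
  · exact prm.measurable_pLOS
  · exact measurable_const.sub prm.measurable_pLOS

lemma linkProb_nonneg (k : Link) (r : ℝ) : 0 ≤ prm.linkProb k r := by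
  cases k
  · exact (prm.pLOS_mem_Icc r).1
  · exact sub_nonneg.2 (prm.pLOS_mem_Icc r).2

lemma linkOf_eq_LOS_iff {r u : ℝ} : prm.linkOf r u = Link.LOS ↔ u ≤ prm.pLOS r := by
  unfold linkOf; split_ifs with h <;> simp [h]

lemma linkOf_eq_NLOS_iff {r u : ℝ} : prm.linkOf r u = Link.NLOS ↔ ¬ u ≤ prm.pLOS r := by
  unfold linkOf; split_ifs with h <;> simp [h]

lemma measurable_attenuation (k : Link) : Measurable (prm.attenuation k) := by
  unfold attenuation; fun_prop

lemma attenuation_pos (k : Link) (r : ℝ) : 0 < prm.attenuation k r := by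
  have := prm.h_pos
  unfold attenuation; positivity

lemma cD_mem : prm.cD ∈ Set.Icc (0 : ℝ) 1 := by
  have h := prm.beamD_mem
  have := Real.pi_pos
  exact ⟨div_nonneg h.1 (by positivity), (div_le_one (by positivity)).2 h.2⟩

lemma cU_mem : prm.cU ∈ Set.Icc (0 : ℝ) 1 := by
  have h := prm.beamU_mem
  have := Real.pi_pos
  exact ⟨div_nonneg h.1 (by positivity), (div_le_one (by positivity)).2 h.2⟩

lemma gainProb_nonneg (e : Fin 4) : 0 ≤ prm.gainProb e := by
  have h1 := prm.cD_mem
  have h2 := prm.cU_mem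
  have h3 := sub_nonneg.2 h1.2
  have h4 := sub_nonneg.2 h2.2
  fin_cases e
  · exact mul_nonneg h1.1 h2.1
  · exact mul_nonneg h1.1 h4
  · exact mul_nonneg h3 h2.1
  · exact mul_nonneg h3 h4

lemma sum_gainProb : ∑ e, prm.gainProb e = 1 := by
  simp only [gainProb, Fin.sum_univ_four, Matrix.cons_val]
  ring

lemma gain_nonneg (e : Fin 4) : 0 ≤ prm.gain e := by
  have h1 := prm.GdM_pos.le
  have h2 := prm.GuM_pos.le
  have h3 := prm.Gdm_nonneg
  have h4 := prm.Gum_nonneg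
  fin_cases e
  · exact mul_nonneg h1 h2
  · exact mul_nonneg h1 h4
  · exact mul_nonneg h3 h2
  · exact mul_nonneg h3 h4

instance : IsProbabilityMeasure prm.gainLaw where
  measure_univ := by
    simp only [gainLaw, Measure.coe_finsetSum, Finset.sum_apply, Measure.smul_apply, measure_univ,
      smul_eq_mul, mul_one]
    rw [← ENNReal.ofReal_sum_of_nonneg fun e _ => prm.gainProb_nonneg e, sum_gainProb,
      ENNReal.ofReal_one]

instance (k : Link) : IsProbabilityMeasure (prm.fadingLaw k) :=
  have h : (0 : ℝ) < prm.m k := Nat.cast_pos.2 (prm.m_pos k)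
  isProbabilityMeasure_gammaMeasure h h

instance : SigmaFinite prm.interfererIntensity := by
  exact inferInstanceAs (SigmaFinite (prm.lamDC.toNNReal •
    (volume : Measure Plane).restrict (Metric.ball 0 (prm.R / 2))ᶜ))

lemma integral_gainLaw (f : ℝ → ℝ) :
    ∫ x, f x ∂prm.gainLaw = ∑ e, prm.gainProb e * f (prm.gain e) := by
  rw [gainLaw, integral_finsetSum_measure fun e _ =>
    (integrable_dirac (by simp)).smul_measure ENNReal.ofReal_ne_top]
  simp [integral_smul_measure, ENNReal.toReal_ofReal (prm.gainProb_nonneg _)]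

lemma lamDC_pos : 0 < prm.lamDC := by
  have := prm.tDC_pos
  have := prm.Ts_pos
  have := prm.R_pos
  unfold lamDC; positivity

/-- Laplace transform at `s` of the power received over an interfering link in the state `k` at
ground distance `r` with antenna gain `gain e`. -/
noncomputable def linkLaplace (k : Link) (s : ℝ) (e : Fin 4) (r : ℝ) : ℝ :=
  (1 + s * prm.P * prm.gain e * prm.attenuation k r / prm.m k) ^ (-(prm.m k : ℤ))

lemma measurable_linkLaplace (k : Link) (s : ℝ) (e : Fin 4) :
    Measurable (prm.linkLaplace k s e) := by
  have := prm.measurable_attenuation k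
  unfold linkLaplace
  simp only [zpow_neg, zpow_natCast]
  fun_prop

lemma linkLaplace_le_one (k : Link) {s : ℝ} (hs : 0 ≤ s) (e : Fin 4) (r : ℝ) :
    prm.linkLaplace k s e r ≤ 1 := by
  have h1 := prm.P_pos
  have h2 := prm.gain_nonneg e
  have h3 := prm.attenuation_pos k r
  unfold linkLaplace
  rw [zpow_neg, zpow_natCast]
  refine inv_le_one_of_one_le₀ (one_le_pow₀ ?_)
  have : 0 ≤ s * prm.P * prm.gain e * prm.attenuation k r / prm.m k := by positivity
  linarith

lemma integral_expNeg_fadingLaw (k : Link) {s : ℝ} (hs : 0 ≤ s) (e : Fin 4) (r : ℝ) :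
    ∫ x, expNeg (ENNReal.ofReal s *
      ENNReal.ofReal (prm.P * x * prm.gain e * prm.attenuation k r)) ∂prm.fadingLaw k =
      prm.linkLaplace k s e r := by
  have h0 : (0 : ℝ) < prm.m k := Nat.cast_pos.2 (prm.m_pos k)
  have h1 := prm.P_pos
  have h2 := prm.gain_nonneg e
  have h3 := prm.attenuation_pos k r
  have h : ∀ x, ENNReal.ofReal s * ENNReal.ofReal (prm.P * x * prm.gain e * prm.attenuation k r) =
      ENNReal.ofReal (s * prm.P * prm.gain e * prm.attenuation k r * x) := fun x => by
    rw [← ENNReal.ofReal_mul hs]; congr 1; ring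
  simp_rw [h]
  rw [fadingLaw, integral_expNeg_gammaMeasure h0 h0 (by positivity), linkLaplace,
    ← Real.rpow_intCast]
  simp

/-- The rate at which interfering links in the state `k` thin out the intensity at ground
distance `r`. -/
noncomputable def linkRate (k : Link) (s r : ℝ) : ℝ :=
  prm.linkProb k r * ∑ e, prm.gainProb e * (1 - prm.linkLaplace k s e r)

lemma linkRate_nonneg (k : Link) {s : ℝ} (hs : 0 ≤ s) (r : ℝ) : 0 ≤ prm.linkRate k s r :=
  mul_nonneg (prm.linkProb_nonneg k r) (Finset.sum_nonneg fun e _ =>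
    mul_nonneg (prm.gainProb_nonneg e) (sub_nonneg.2 (prm.linkLaplace_le_one k hs e r)))

lemma measurable_linkRate (k : Link) (s : ℝ) : Measurable (prm.linkRate k s) := by
  have := prm.measurable_linkLaplace k s
  have := prm.measurable_linkProb k
  unfold linkRate
  fun_prop

/-- The sum over antenna gains moves inside the radial integral, and the factor `2π r` is the
Jacobian of polar coordinates in the plane. -/
lemma laplaceExponent_eq_lintegral (k : Link) {s : ℝ} (hs : 0 ≤ s) :
    prm.laplaceExponent k s =
      ∫⁻ x, ENNReal.ofReal (prm.linkRate k s ‖x‖) ∂prm.interfererIntensity := by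
  have hR := prm.R_pos
  have hl := prm.measurable_linkLaplace k s
  have hp := prm.measurable_linkProb k
  rw [interfererIntensity, lintegral_smul_measure, setLIntegral_compl_ball_fun_norm
    (f := fun r => ENNReal.ofReal (prm.linkRate k s r)) (prm.measurable_linkRate k s).ennreal_ofReal
    (by positivity), laplaceExponent, mul_comm (2 * Real.pi),
    ENNReal.ofReal_mul prm.lamDC_pos.le, smul_eq_mul, mul_assoc]
  congr 2
  simp_rw [← lintegral_const_mul' _ _ ENNReal.ofReal_ne_top]
  rw [← lintegral_finsetSum' _ fun e _ => by
    refine Measurable.aemeasurable (Measurable.const_mul (Measurable.ennreal_ofReal ?_) _)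
    exact (hp.mul (measurable_const.sub (hl e))).mul measurable_id]
  refine setLIntegral_congr_fun measurableSet_Ioi fun r hr => ?_
  have hr0 : 0 ≤ r := (lt_trans (half_pos hR) hr).le
  rw [← ENNReal.ofReal_mul (prm.linkRate_nonneg k hs r)]
  simp_rw [← ENNReal.ofReal_mul (prm.gainProb_nonneg _)]
  rw [← ENNReal.ofReal_sum_of_nonneg]
  · congr 1
    rw [linkRate, Finset.mul_sum, Finset.sum_mul]
    exact Finset.sum_congr rfl fun e _ => by rw [linkLaplace]; ring
  · intro e _
    exact mul_nonneg (prm.gainProb_nonneg e) (mul_nonneg (mul_nonneg (prm.linkProb_nonneg k r)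
      (sub_nonneg.2 (prm.linkLaplace_le_one k hs e r))) hr0)

end Params

/-! ### The Laplace transform of the interference -/

namespace Params

variable (prm : Params)

/-- Law of the marks of an interfering device. -/
noncomputable def markLaw : Measure (ℝ × ℝ × ℝ × ℝ) :=
  (volume.restrict (Set.Icc (0 : ℝ) 1)).prod
    ((prm.fadingLaw Link.LOS).prod ((prm.fadingLaw Link.NLOS).prod prm.gainLaw))

instance isProbabilityMeasure_restrict_Icc :
    IsProbabilityMeasure ((volume : Measure ℝ).restrict (Set.Icc (0 : ℝ) 1)) :=
  ⟨by simp⟩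

lemma integral_ite_le {p : ℝ} (hp : p ∈ Set.Icc (0 : ℝ) 1) (x y : ℝ) :
    ∫ u in Set.Icc (0 : ℝ) 1, (if u ≤ p then x else y) = p * x + (1 - p) * y := by
  have h : ∀ u : ℝ, (if u ≤ p then x else y) = (Set.Iic p).indicator (fun _ => x - y) u + y :=
    fun u => by by_cases hu : u ≤ p <;> simp [hu]
  simp_rw [h]
  rw [integral_add ((integrable_const _).indicator measurableSet_Iic) (integrable_const _),
    integral_indicator_const _ measurableSet_Iic]
  have h2 : Set.Iic p ∩ Set.Icc 0 1 = Set.Icc 0 p := by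
    ext u; simp only [Set.mem_inter_iff, Set.mem_Iic, Set.mem_Icc]
    exact ⟨fun h => ⟨h.2.1, h.1⟩, fun h => ⟨h.2, h.1, h.2.trans hp.2⟩⟩
  rw [measureReal_restrict_apply measurableSet_Iic, h2]
  simp [measureReal_def, hp.1]
  ring

/-- Power received over an interfering link in the state `k` at ground distance `r` with fading
gain `x` and antenna gain `y`. -/
noncomputable def rxPower (k : Link) (r x y : ℝ) : ℝ≥0∞ :=
  ENNReal.ofReal (prm.P * x * y * prm.attenuation k r)

/-- Power received from an interfering device at `x` with the marks `y`, weighted by `s` according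
to the state of the link. -/
noncomputable def weightedPower (s : Link → ℝ) (x : Plane) (y : ℝ × ℝ × ℝ × ℝ) : ℝ≥0∞ :=
  if y.1 ≤ prm.pLOS ‖x‖ then
    ENNReal.ofReal (s Link.LOS) * prm.rxPower Link.LOS ‖x‖ y.2.1 y.2.2.2
  else ENNReal.ofReal (s Link.NLOS) * prm.rxPower Link.NLOS ‖x‖ y.2.2.1 y.2.2.2

lemma measurable_weightedPower (s : Link → ℝ) :
    Measurable (Function.uncurry (prm.weightedPower s)) := by
  have h := fun k => prm.measurable_attenuation k
  have hp := prm.measurable_pLOS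
  unfold Function.uncurry weightedPower rxPower
  refine Measurable.ite (measurableSet_le (by fun_prop) (by fun_prop)) ?_ ?_
  · have := h Link.LOS
    fun_prop
  · have := h Link.NLOS
    fun_prop

lemma measurable_rxPower (k : Link) (r : ℝ) :
    Measurable fun p : ℝ × ℝ => prm.rxPower k r p.1 p.2 := by
  unfold rxPower; fun_prop

lemma integral_expNeg_rxPower (k : Link) {s : ℝ} (hs : 0 ≤ s) (r : ℝ) :
    ∫ p, expNeg (ENNReal.ofReal s * prm.rxPower k r p.1 p.2)
      ∂((prm.fadingLaw k).prod prm.gainLaw) =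
      ∑ e, prm.gainProb e * prm.linkLaplace k s e r := by
  have hm : Measurable fun p : ℝ × ℝ => ENNReal.ofReal s * prm.rxPower k r p.1 p.2 :=
    (prm.measurable_rxPower k r).const_mul _
  rw [integral_prod _ (integrable_expNeg hm)]
  simp_rw [integral_gainLaw]
  rw [integral_finsetSum]
  · refine Finset.sum_congr rfl fun e _ => ?_
    rw [integral_const_mul]
    congr 1
    exact prm.integral_expNeg_fadingLaw k hs e r
  · intro e _
    have hme : Measurable fun x : ℝ => ENNReal.ofReal s * prm.rxPower k r x (prm.gain e) :=
      hm.comp (by fun_prop : Measurable fun x : ℝ => (x, prm.gain e))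
    exact (integrable_expNeg hme).const_mul _

lemma integral_expNeg_weightedPower {s : Link → ℝ} (hs : ∀ k, 0 ≤ s k) (x : Plane) :
    1 - ∫ y, expNeg (prm.weightedPower s x y) ∂prm.markLaw =
      prm.linkRate Link.LOS (s Link.LOS) ‖x‖ + prm.linkRate Link.NLOS (s Link.NLOS) ‖x‖ := by
  set r := ‖x‖ with hr
  have hm : Measurable fun y => prm.weightedPower s x y :=
    (prm.measurable_weightedPower s).comp measurable_prodMk_left
  have hms : Measurable fun z : (ℝ × ℝ × ℝ) × ℝ => prm.weightedPower s x z.swap :=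
    hm.comp measurable_swap
  set q := prm.pLOS r with hq
  let A : Link → ℝ → ℝ → ℝ := fun k h g => expNeg (ENNReal.ofReal (s k) * prm.rxPower k r h g)
  have hA : ∀ k, Measurable fun p : ℝ × ℝ => ENNReal.ofReal (s k) * prm.rxPower k r p.1 p.2 :=
    fun k => (prm.measurable_rxPower k r).const_mul _
  have hsplit : ∀ y : ℝ × ℝ × ℝ × ℝ, expNeg (prm.weightedPower s x y) =
      if y.1 ≤ q then A Link.LOS y.2.1 y.2.2.2 else A Link.NLOS y.2.2.1 y.2.2.2 := fun y => by
    simp only [weightedPower, ← hr, ← hq, A]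
    split_ifs <;> rfl
  -- The swap makes the uniform selector the innermost variable, so that it is averaged first and
  -- produces the weights `q` and `1 - q`.
  rw [markLaw, ← integral_prod_swap, integral_prod _
    (integrable_expNeg hms)]
  have hq01 : q ∈ Set.Icc (0 : ℝ) 1 := prm.pLOS_mem_Icc r
  simp only [Prod.swap_prod_mk, hsplit, integral_ite_le hq01]
  have hL : Measurable fun z : ℝ × ℝ × ℝ =>
      ENNReal.ofReal (s Link.LOS) * prm.rxPower Link.LOS r z.1 z.2.2 :=
    (hA Link.LOS).comp (by fun_prop : Measurable fun z : ℝ × ℝ × ℝ => (z.1, z.2.2))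
  have hN : Measurable fun z : ℝ × ℝ × ℝ =>
      ENNReal.ofReal (s Link.NLOS) * prm.rxPower Link.NLOS r z.2.1 z.2.2 :=
    (hA Link.NLOS).comp (by fun_prop : Measurable fun z : ℝ × ℝ × ℝ => (z.2.1, z.2.2))
  rw [integral_add ((integrable_expNeg hL).const_mul _) ((integrable_expNeg hN).const_mul _),
    integral_const_mul, integral_const_mul]
  have e1 : ∫ z : ℝ × ℝ × ℝ, A Link.LOS z.1 z.2.2 ∂((prm.fadingLaw Link.LOS).prod
      ((prm.fadingLaw Link.NLOS).prod prm.gainLaw)) =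
      ∑ e, prm.gainProb e * prm.linkLaplace Link.LOS (s Link.LOS) e r := by
    rw [← prm.integral_expNeg_rxPower _ (hs _), integral_prod _ (integrable_expNeg hL),
      integral_prod _ (integrable_expNeg (hA Link.LOS))]
    refine integral_congr_ae (ae_of_all _ fun h => ?_)
    simpa [A] using integral_fun_snd (μ := prm.fadingLaw Link.NLOS) (ν := prm.gainLaw)
      (fun g => A Link.LOS h g)
  have e2 : ∫ z : ℝ × ℝ × ℝ, A Link.NLOS z.2.1 z.2.2 ∂((prm.fadingLaw Link.LOS).prod
      ((prm.fadingLaw Link.NLOS).prod prm.gainLaw)) =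
      ∑ e, prm.gainProb e * prm.linkLaplace Link.NLOS (s Link.NLOS) e r := by
    rw [← prm.integral_expNeg_rxPower _ (hs _)]
    simpa [A] using integral_fun_snd (μ := prm.fadingLaw Link.LOS)
      (ν := (prm.fadingLaw Link.NLOS).prod prm.gainLaw) (fun z => A Link.NLOS z.1 z.2)
  rw [e1, e2]
  -- The gain probabilities sum to `1`, as do the two link probabilities; this is what splits one
  -- minus the average into two rates.
  have hsum : ∀ k, ∑ e, prm.gainProb e * (1 - prm.linkLaplace k (s k) e r) =
      1 - ∑ e, prm.gainProb e * prm.linkLaplace k (s k) e r := fun k => by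
    simp_rw [mul_sub, mul_one, Finset.sum_sub_distrib, sum_gainProb]
  simp only [linkRate, hsum, linkProb, ← hq]
  ring

lemma laplaceExponent_zero (k : Link) : prm.laplaceExponent k 0 = 0 := by
  simp [laplaceExponent]

lemma laplace_zero (k : Link) : prm.laplace k 0 = 1 := by
  simp [laplace, laplaceExponent_zero]

end Params

namespace Model

variable {prm : Params} {Ω : Type*} [MeasurableSpace Ω] {μ : Measure Ω} (M : Model prm μ)

/-- The marks of the `i`-th interfering device. -/
def mark (i : ℕ) (ω : Ω) : ℝ × ℝ × ℝ × ℝ := (M.U i ω, M.H Link.LOS i ω, M.H Link.NLOS i ω, M.G i ω)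

lemma measurable_mark (i : ℕ) : Measurable (M.mark i) :=
  (M.measurable_U i).prodMk ((M.measurable_H _ i).prodMk
    ((M.measurable_H _ i).prodMk (M.measurable_G i)))

/-- Each device feeds exactly one of the two interferences, so their weighted sum is a single sum
over marked points, as the Laplace functional requires. -/
lemma interference_add_interference (s : Link → ℝ) (ω : Ω) :
    ENNReal.ofReal (s Link.LOS) * M.interference Link.LOS ω +
      ENNReal.ofReal (s Link.NLOS) * M.interference Link.NLOS ω =
      ∑' i, prm.weightedPower s (M.X i ω) (M.mark i ω) := by
  unfold interference
  rw [← ENNReal.tsum_mul_left, ← ENNReal.tsum_mul_left, ← ENNReal.tsum_add]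
  congr 1; ext i
  simp only [link, prm.linkOf_eq_LOS_iff, prm.linkOf_eq_NLOS_iff, Params.weightedPower, mark,
    Params.rxPower]
  by_cases h : M.U i ω ≤ prm.pLOS ‖M.X i ω‖ <;> simp [h]

/-- Joint Laplace transform of the interference from the two link states. -/
theorem integral_expNeg_interference [IsProbabilityMeasure μ] {s : Link → ℝ}
    (hs : ∀ k, 0 ≤ s k) :
    ∫ ω, expNeg (ENNReal.ofReal (s Link.LOS) * M.interference Link.LOS ω +
      ENNReal.ofReal (s Link.NLOS) * M.interference Link.NLOS ω) ∂μ =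
      prm.laplace Link.LOS (s Link.LOS) * prm.laplace Link.NLOS (s Link.NLOS) := by
  simp_rw [M.interference_add_interference]
  rw [M.poisson.integral_expNeg_tsum_marked (Y := M.mark) (ρ := prm.markLaw) M.measurable_mark
    M.mark_law M.mark_indep M.position_mark_indep (prm.measurable_weightedPower s),
    Params.laplace, Params.laplace, ← expNeg_add]
  congr 1
  simp_rw [prm.integral_expNeg_weightedPower hs]
  rw [prm.laplaceExponent_eq_lintegral _ (hs _), prm.laplaceExponent_eq_lintegral _ (hs _),
    ← lintegral_add_left]
  · refine lintegral_congr fun x => ?_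
    exact ENNReal.ofReal_add (prm.linkRate_nonneg _ (hs _) _) (prm.linkRate_nonneg _ (hs _) _)
  · exact ((prm.measurable_linkRate _ _).comp measurable_norm).ennreal_ofReal

theorem integral_expNeg_mul_interference [IsProbabilityMeasure μ] (k : Link) {s : ℝ}
    (hs : 0 ≤ s) :
    ∫ ω, expNeg (ENNReal.ofReal s * M.interference k ω) ∂μ = prm.laplace k s := by
  -- A zero weight removes the other state, whose transform at `0` is `1`.
  have h := M.integral_expNeg_interference (s := fun l => if l = k then s else 0)
    fun l => by positivity
  cases k <;> simpa [prm.laplace_zero] using h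

lemma measurable_interference (k : Link) : Measurable (M.interference k) := by
  have h : M.interference k = fun ω => ∑' i, prm.weightedPower (fun l => if l = k then 1 else 0)
      (M.X i ω) (M.mark i ω) := by
    ext ω
    rw [← M.interference_add_interference]
    cases k <;> simp
  rw [h]
  refine Measurable.tsum fun i => ?_
  exact (prm.measurable_weightedPower fun l => if l = k then 1 else 0).comp
    ((M.poisson.measurable i).prodMk (M.measurable_mark i))

lemma measurable_disturbance : Measurable M.disturbance :=
  ((M.measurable_interference _).add (M.measurable_interference _)).add measurable_const

end Model

/-! ### Alzer's inequality for integer shape parameters -/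

/-- A function on `[0, ∞)` that vanishes at both ends and is antitone once it starts to decrease
is nonnegative. -/
lemma nonneg_of_deriv_nonpos_of_le {f f' : ℝ → ℝ} (hf : ∀ x, HasDerivAt f (f' x) x)
    (h0 : f 0 = 0) (hlim : Tendsto f atTop (𝓝 0))
    (h : ∀ x y, 0 < x → x ≤ y → f' x < 0 → f' y ≤ 0) {x : ℝ} (hx : 0 ≤ x) : 0 ≤ f x := by
  by_contra! hneg
  have hx0 : 0 < x := lt_of_le_of_ne hx fun h => by rw [← h, h0] at hneg; exact hneg.false
  have hcont : Continuous f := continuous_iff_continuousAt.2 fun y => (hf y).continuousAt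
  -- A negative value at `x` forces a negative slope somewhere before it. From there on the function
  -- is antitone with limit `0`, so it cannot be negative at `x`.
  obtain ⟨c, hc, hslope⟩ := exists_hasDerivAt_eq_slope f f' hx0 hcont.continuousOn fun y _ => hf y
  have hc' : f' c < 0 := by
    rw [hslope, h0]
    exact div_neg_of_neg_of_pos (by linarith) (by linarith)
  have hanti : AntitoneOn f (Set.Ici c) := by
    refine antitoneOn_of_deriv_nonpos (convex_Ici c) hcont.continuousOn
      (fun y _ => (hf y).differentiableAt.differentiableWithinAt) fun y hy => ?_
    rw [interior_Ici] at hy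
    rw [(hf y).deriv]
    exact h c y hc.1 (le_of_lt hy) hc'
  have : 0 ≤ f x := by
    refine le_of_tendsto hlim ?_
    filter_upwards [eventually_ge_atTop x] with y hy
    exact hanti hc.2.le (hc.2.le.trans hy) hy
  linarith

/-- The mean of `exp (-z t)` over `t ∈ [0, 1]`. -/
noncomputable def expMean (z : ℝ) : ℝ := ∫ t in (0 : ℝ)..1, Real.exp (-z * t)

/-- Writing `1 - exp (-z)` as `z` times a positive mean extracts a power of `x` from the derivative
of `(1 - exp (-c x)) ^ (n + 1)`, matching the power in the Gamma density. -/
lemma mul_expMean (z : ℝ) : z * expMean z = 1 - Real.exp (-z) := by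
  have h : ∀ t ∈ Set.uIcc (0 : ℝ) 1,
      HasDerivAt (fun t => -Real.exp (-z * t)) (z * Real.exp (-z * t)) t := fun t _ => by
    have := (((hasDerivAt_id' t).const_mul (-z)).exp).neg
    refine this.congr_deriv ?_
    ring
  rw [expMean, ← intervalIntegral.integral_const_mul,
    intervalIntegral.integral_eq_sub_of_hasDerivAt h
      (Continuous.intervalIntegrable (by fun_prop) _ _)]
  simp
  ring

lemma expMean_pos (z : ℝ) : 0 < expMean z :=
  intervalIntegral.intervalIntegral_pos_of_pos
    (Continuous.intervalIntegrable (by fun_prop) _ _) (fun t => Real.exp_pos _) one_pos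

lemma expMean_antitone : Antitone expMean := by
  intro z w hzw
  refine intervalIntegral.integral_mono_on zero_le_one
    (Continuous.intervalIntegrable (by fun_prop) _ _)
    (Continuous.intervalIntegrable (by fun_prop) _ _) fun t ht => ?_
  refine Real.exp_le_exp.2 ?_
  nlinarith [ht.1]

/-- Monotonicity of power means for the function `exp (-t)` on `[0, 1]`. -/
lemma expMean_rpow_le (z : ℝ) {q : ℝ} (hq : 1 ≤ q) : expMean z ^ q ≤ expMean (q * z) := by
  have ha := expMean_pos z
  set a := expMean z with hadef
  have haq : 0 < a ^ q := Real.rpow_pos_of_pos ha q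
  have hb : ∀ t : ℝ, 1 - q + q / a * Real.exp (-z * t) ≤ Real.exp (-(q * z) * t) / a ^ q :=
    fun t => by
      -- Bernoulli's inequality at the integrand divided by its mean, minus one: the tangent line at
      -- the mean. The linear side integrates to `1` over `[0, 1]`.
      have h := one_add_mul_self_le_rpow_one_add (s := Real.exp (-z * t) / a - 1) (p := q)
        (by have : 0 ≤ Real.exp (-z * t) / a := by positivity
            linarith) hq
      rw [add_sub_cancel, Real.div_rpow (Real.exp_nonneg _) ha.le, ← Real.exp_mul] at h
      calc _ = 1 + q * (Real.exp (-z * t) / a - 1) := by ring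
        _ ≤ _ := h
        _ = _ := by congr 2; ring
  have hint := intervalIntegral.integral_mono_on (μ := volume) (zero_le_one' ℝ)
    (Continuous.intervalIntegrable (by fun_prop) _ _)
    (Continuous.intervalIntegrable (by fun_prop) _ _) fun t _ => hb t
  rw [intervalIntegral.integral_add (by simp)
    (Continuous.intervalIntegrable (by fun_prop) _ _), intervalIntegral.integral_const_mul,
    intervalIntegral.integral_div, ← expMean, ← expMean, ← hadef, div_mul_cancel₀ _ ha.ne'] at hint
  simp only [intervalIntegral.integral_const, sub_zero, one_smul, sub_add_cancel] at hint
  rwa [le_div_iff₀ haq, one_mul] at hint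

lemma hasDerivAt_one_sub_exp_pow (c : ℝ) (n : ℕ) (x : ℝ) :
    HasDerivAt (fun x => (1 - Real.exp (-(c * x))) ^ (n + 1))
      ((n + 1) * (c * x * expMean (c * x)) ^ n * (c * Real.exp (-(c * x)))) x := by
  have h := (((hasDerivAt_id' x).const_mul c).fun_neg.exp.const_sub 1).fun_pow (n + 1)
  rw [mul_expMean]
  refine h.congr_deriv ?_
  push_cast
  ring

lemma tendsto_one_sub_exp_pow {c : ℝ} (hc : 0 < c) (n : ℕ) :
    Tendsto (fun x => (1 - Real.exp (-(c * x))) ^ n) atTop (𝓝 1) := by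
  have h : Tendsto (fun x => Real.exp (-(c * x))) atTop (𝓝 0) :=
    Real.tendsto_exp_neg_atTop_nhds_zero.comp (tendsto_id.const_mul_atTop hc)
  simpa using (h.const_sub 1).pow n

section Alzer

variable {n : ℕ} {g : ℝ} {F : ℝ → ℝ}

/-- Alzer's lower bound for the distribution function of the Gamma law with integer shape `n + 1`
and mean `1`. -/
lemma one_sub_exp_pow_le_of_hasDerivAt (hg : 0 < g)
    (hF : ∀ x, HasDerivAt F ((n + 1) * g ^ (n + 1) * x ^ n * Real.exp (-((n + 1) * x))) x)
    (h0 : F 0 = 0) (hlim : Tendsto F atTop (𝓝 1)) {x : ℝ} (hx : 0 ≤ x) :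
    (1 - Real.exp (-(g * x))) ^ (n + 1) ≤ F x := by
  rw [← sub_nonneg]
  refine nonneg_of_deriv_nonpos_of_le (f := fun x => F x - (1 - Real.exp (-(g * x))) ^ (n + 1))
    (fun x => (hF x).sub (hasDerivAt_one_sub_exp_pow g n x)) (by simp [h0])
    (by simpa using hlim.sub (tendsto_one_sub_exp_pow hg (n + 1))) ?_ hx
  -- With the common positive factor removed, the sign of the derivative depends only on whether
  -- `exp ((n + 1 - g) x) * expMean (g x) ^ n` exceeds `1`.
  have hfac : ∀ x : ℝ, (n + 1) * g ^ (n + 1) * x ^ n * Real.exp (-((n + 1) * x)) -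
      (n + 1) * (g * x * expMean (g * x)) ^ n * (g * Real.exp (-(g * x))) =
      (n + 1) * g ^ (n + 1) * x ^ n * Real.exp (-((n + 1) * x)) *
        (1 - Real.exp ((n + 1 - g) * x) * expMean (g * x) ^ n) := fun x => by
    have : Real.exp (-(g * x)) = Real.exp (-((n + 1) * x)) * Real.exp ((n + 1 - g) * x) := by
      rw [← Real.exp_add]; congr 1; ring
    rw [this]; ring
  intro x y hx0 hxy hneg
  rw [hfac] at hneg ⊢
  have hy0 : 0 < y := hx0.trans_le hxy
  have h1 : 1 ≤ Real.exp ((n + 1 - g) * x) * expMean (g * x) ^ n := by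
    by_contra! hlt
    have : 0 ≤ (n + 1) * g ^ (n + 1) * x ^ n * Real.exp (-((n + 1) * x)) *
      (1 - Real.exp ((n + 1 - g) * x) * expMean (g * x) ^ n) :=
      mul_nonneg (by positivity) (by linarith)
    linarith
  have hq : 1 ≤ y / x := (one_le_div hx0).2 hxy
  have hA := expMean_pos (g * x)
  refine mul_nonpos_of_nonneg_of_nonpos (by positivity) (sub_nonpos.2 ?_)
  -- Raising to the power `y / x ≥ 1` rescales the exponential exactly from `x` to `y`;
  -- `expMean_rpow_le` does the same for the mean, as an inequality.
  calc (1 : ℝ) ≤ (Real.exp ((n + 1 - g) * x) * expMean (g * x) ^ n) ^ (y / x) :=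
        Real.one_le_rpow h1 (by positivity)
    _ = Real.exp ((n + 1 - g) * y) * (expMean (g * x) ^ (y / x)) ^ n := by
        rw [Real.mul_rpow (Real.exp_nonneg _) (by positivity), ← Real.exp_mul,
          ← Real.rpow_natCast, ← Real.rpow_natCast, ← Real.rpow_mul hA.le, ← Real.rpow_mul hA.le,
          mul_comm (n : ℝ)]
        congr 2
        field_simp
    _ ≤ Real.exp ((n + 1 - g) * y) * expMean (g * y) ^ n := by
        have h := expMean_rpow_le (g * x) hq
        rw [show y / x * (g * x) = g * y by field_simp] at h
        gcongr

/-- Here both derivatives carry the same exponential, so the sign is decided by a multiple of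
`expMean ((n + 1) x) ^ n` minus a constant, which is antitone. -/
lemma le_one_sub_exp_pow_of_hasDerivAt
    (hF : ∀ x, HasDerivAt F ((n + 1) * g ^ (n + 1) * x ^ n * Real.exp (-((n + 1) * x))) x)
    (h0 : F 0 = 0) (hlim : Tendsto F atTop (𝓝 1)) {x : ℝ} (hx : 0 ≤ x) :
    F x ≤ (1 - Real.exp (-((n + 1) * x))) ^ (n + 1) := by
  have hn : (0 : ℝ) < n + 1 := by positivity
  rw [← sub_nonneg]
  refine nonneg_of_deriv_nonpos_of_le
    (f := fun x => (1 - Real.exp (-((n + 1) * x))) ^ (n + 1) - F x)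
    (fun x => (hasDerivAt_one_sub_exp_pow (n + 1) n x).sub (hF x)) (by simp [h0])
    (by simpa using (tendsto_one_sub_exp_pow hn (n + 1)).sub hlim) ?_ hx
  have hfac : ∀ x : ℝ, (n + 1) * ((n + 1) * x * expMean ((n + 1) * x)) ^ n *
      ((n + 1) * Real.exp (-((n + 1) * x))) -
      (n + 1) * g ^ (n + 1) * x ^ n * Real.exp (-((n + 1) * x)) =
      (n + 1) * x ^ n * Real.exp (-((n + 1) * x)) *
        ((n + 1) ^ (n + 1) * expMean ((n + 1) * x) ^ n - g ^ (n + 1)) := fun x => by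
    rw [mul_pow, mul_pow, pow_succ (n + 1 : ℝ) n]; ring
  intro x y hx0 hxy hneg
  rw [hfac] at hneg ⊢
  have hy0 : 0 < y := hx0.trans_le hxy
  have h1 : (n + 1 : ℝ) ^ (n + 1) * expMean ((n + 1) * x) ^ n ≤ g ^ (n + 1) := by
    by_contra! hlt
    have : 0 ≤ (n + 1) * x ^ n * Real.exp (-((n + 1) * x)) *
        ((n + 1 : ℝ) ^ (n + 1) * expMean ((n + 1) * x) ^ n - g ^ (n + 1)) :=
      mul_nonneg (by positivity) (by linarith)
    linarith
  refine mul_nonpos_of_nonneg_of_nonpos (by positivity) (sub_nonpos.2 (le_trans ?_ h1))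
  have := expMean_pos ((n + 1) * y)
  gcongr
  exact expMean_antitone (by gcongr)

end Alzer

/-! ### The Gamma tail against Alzer's tails -/

namespace Params

variable (prm : Params)

lemma g_pos (k : Link) : 0 < prm.g k := by
  have h : (0 : ℝ) < prm.m k := Nat.cast_pos.2 (prm.m_pos k)
  have := Nat.factorial_pos (prm.m k)
  unfold g; positivity

/-- Alzer's coefficient is chosen so that `m * g ^ m` is the normalizing constant `m ^ m / (m - 1)!`
of the Gamma density. -/
lemma g_pow (k : Link) : prm.g k ^ prm.m k = (prm.m k : ℝ) ^ prm.m k / (prm.m k)! := by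
  have h : (prm.m k : ℝ) ≠ 0 := Nat.cast_ne_zero.2 (prm.m_pos k).ne'
  rw [g, mul_pow, ← Real.rpow_natCast (_ ^ (_ : ℝ)), ← Real.rpow_mul (by positivity),
    div_mul_cancel₀ _ h, Real.rpow_neg_one, div_eq_mul_inv]

lemma tendsto_cdf_fadingLaw (k : Link) : Tendsto (cdf (prm.fadingLaw k)) atTop (𝓝 1) :=
  tendsto_cdf_atTop _

/-- Distribution function of the fading gain on `[0, ∞)`, extended analytically. -/
noncomputable def fadingCDF (k : Link) (x : ℝ) : ℝ :=
  ∫ t in (0 : ℝ)..x, prm.m k * prm.g k ^ prm.m k * t ^ (prm.m k - 1) * Real.exp (-(prm.m k * t))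

lemma hasDerivAt_fadingCDF (k : Link) (x : ℝ) : HasDerivAt (prm.fadingCDF k)
    (prm.m k * prm.g k ^ prm.m k * x ^ (prm.m k - 1) * Real.exp (-(prm.m k * x))) x := by
  have hc : Continuous fun t : ℝ => prm.m k * prm.g k ^ prm.m k * t ^ (prm.m k - 1) *
    Real.exp (-(prm.m k * t)) := by fun_prop
  exact intervalIntegral.integral_hasDerivAt_right (hc.intervalIntegrable _ _)
    (hc.stronglyMeasurableAtFilter _ _) hc.continuousAt

/-- The true distribution function is replaced by `fadingCDF` because the sign argument needs a
derivative on all of `ℝ`; the two agree on the half-line that matters. -/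
lemma cdf_fadingLaw (k : Link) {x : ℝ} (hx : 0 ≤ x) :
    cdf (prm.fadingLaw k) x = prm.fadingCDF k x := by
  have h : (0 : ℝ) < prm.m k := Nat.cast_pos.2 (prm.m_pos k)
  have hi : Integrable (gammaPDFReal (prm.m k) (prm.m k)) :=
    integrable_of_integral_eq_one (integral_gammaPDFReal h h)
  have h0 : ∫ t in Set.Iic (0 : ℝ), gammaPDFReal (prm.m k) (prm.m k) t = 0 := by
    rw [integral_Iic_eq_integral_Iio]
    exact setIntegral_eq_zero_of_forall_eq_zero fun t ht => by
      simp [gammaPDFReal, not_le.2 (show t < 0 from ht)]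
  have hs := intervalIntegral.integral_Iic_sub_Iic (μ := volume) (a := 0) (b := x)
    hi.integrableOn hi.integrableOn
  rw [h0, sub_zero] at hs
  rw [fadingLaw, cdf_gammaMeasure_eq_integral h h, hs, fadingCDF]
  refine intervalIntegral.integral_congr fun t ht => ?_
  rw [Set.uIcc_of_le hx] at ht
  obtain ⟨n, hn⟩ := Nat.exists_eq_succ_of_ne_zero (prm.m_pos k).ne'
  simp only [gammaPDFReal, if_pos ht.1, g_pow, Real.rpow_natCast]
  rw [hn]
  simp only [Nat.succ_eq_add_one, Nat.cast_add, Nat.cast_one, add_sub_cancel_right,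
    Real.Gamma_nat_eq_factorial, Real.rpow_natCast, add_tsub_cancel_right, Nat.factorial_succ,
    Nat.cast_mul]
  field_simp

lemma gammaTail_ofReal (k : Link) {x : ℝ} (hx : 0 ≤ x) :
    prm.gammaTail k (ENNReal.ofReal x) = 1 - prm.fadingCDF k x := by
  -- At `x = 0` the truncation in `ENNReal.ofReal` makes the event all of `ℝ`; for positive `x` it
  -- is a genuine half-line, and the missing atom lets it be complemented by `Iic`.
  rcases hx.eq_or_lt with rfl | hx0
  · simp [gammaTail, fadingCDF]
  · have hset : {y : ℝ | ENNReal.ofReal x ≤ ENNReal.ofReal y} = (Set.Iio x)ᶜ := by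
      ext y
      simp [ENNReal.ofReal_le_ofReal_iff', not_le.2 hx0]
    have hac : (prm.fadingLaw k) {x} = 0 :=
      withDensity_absolutelyContinuous _ _ (measure_singleton x)
    rw [gammaTail, hset, probReal_compl_eq_one_sub measurableSet_Iio, ← prm.cdf_fadingLaw k hx,
      cdf_eq_real]
    congr 1
    refine measureReal_congr ?_
    rw [← Set.Iio_union_right]
    exact (union_ae_eq_left_of_ae_eq_empty (ae_eq_empty.2 hac)).symm

lemma tendsto_fadingCDF (k : Link) : Tendsto (prm.fadingCDF k) atTop (𝓝 1) := by
  refine (prm.tendsto_cdf_fadingLaw k).congr' ?_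
  filter_upwards [eventually_ge_atTop 0] with x hx
  exact prm.cdf_fadingLaw k hx

lemma alzerTail_ofReal {c : Link → ℝ} (k : Link) (hc : 0 ≤ c k) {x : ℝ} (hx : 0 ≤ x) :
    prm.alzerTail c k (ENNReal.ofReal x) = 1 - (1 - Real.exp (-(c k * x))) ^ prm.m k := by
  rw [alzerTail, ← ENNReal.ofReal_mul hc, expNeg_ofReal (mul_nonneg hc hx)]

lemma gammaTail_top (k : Link) : prm.gammaTail k ∞ = 0 := by
  simp [gammaTail]

lemma alzerTail_top {c : Link → ℝ} (k : Link) (hc : 0 < c k) : prm.alzerTail c k ∞ = 0 := by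
  simp [alzerTail, ENNReal.mul_top, hc]

/-- Alzer's inequality. -/
theorem gammaTail_le_alzerTail (k : Link) (x : ℝ≥0∞) :
    prm.gammaTail k x ≤ prm.alzerTail prm.g k x := by
  rcases eq_or_ne x ∞ with rfl | hx
  · rw [prm.gammaTail_top, prm.alzerTail_top k (prm.g_pos k)]
  rw [← ENNReal.ofReal_toReal hx, prm.gammaTail_ofReal k ENNReal.toReal_nonneg,
    prm.alzerTail_ofReal k (prm.g_pos k).le ENNReal.toReal_nonneg]
  obtain ⟨n, hn⟩ := Nat.exists_eq_succ_of_ne_zero (prm.m_pos k).ne'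
  have hd := prm.hasDerivAt_fadingCDF k
  rw [hn] at hd ⊢
  exact sub_le_sub_left (one_sub_exp_pow_le_of_hasDerivAt (prm.g_pos k)
    (by simpa using hd) (by simp [fadingCDF]) (prm.tendsto_fadingCDF k) ENNReal.toReal_nonneg) 1

theorem alzerTail_le_gammaTail (k : Link) (x : ℝ≥0∞) :
    prm.alzerTail (fun l => (prm.m l : ℝ)) k x ≤ prm.gammaTail k x := by
  have hm : (0 : ℝ) < prm.m k := Nat.cast_pos.2 (prm.m_pos k)
  rcases eq_or_ne x ∞ with rfl | hx
  · rw [prm.gammaTail_top, prm.alzerTail_top k hm]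
  rw [← ENNReal.ofReal_toReal hx, prm.gammaTail_ofReal k ENNReal.toReal_nonneg,
    prm.alzerTail_ofReal k hm.le ENNReal.toReal_nonneg]
  obtain ⟨n, hn⟩ := Nat.exists_eq_succ_of_ne_zero (prm.m_pos k).ne'
  have hd := prm.hasDerivAt_fadingCDF k
  rw [hn] at hd ⊢
  have := le_one_sub_exp_pow_of_hasDerivAt (by simpa using hd) (by simp [fadingCDF])
    (prm.tendsto_fadingCDF k) (ENNReal.toReal_nonneg (a := x))
  exact sub_le_sub_left (by simpa using this) 1

end Params

/-! ### The typical device -/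

/-- Exchanging the roles of independent variables. -/
lemma map_prodMk_rotate {α β δ Ω : Type*} [MeasurableSpace α] [MeasurableSpace β]
    [MeasurableSpace δ] [MeasurableSpace Ω] {μ : Measure Ω} {A : Ω → α} {B : Ω → β} {D : Ω → δ}
    {ρ : Measure α} {κ : Measure β} {ν : Measure δ} [SFinite ρ] [SFinite κ] [SFinite ν]
    (hA : Measurable A) (hB : Measurable B) (hD : Measurable D)
    (h : μ.map (fun ω => ((A ω, B ω), D ω)) = (ρ.prod κ).prod ν) :
    μ.map (fun ω => (B ω, (A ω, D ω))) = κ.prod (ρ.prod ν) := by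
  have hmp := (measurePreserving_prodAssoc κ ρ ν).comp
    ((Measure.measurePreserving_swap (μ := ρ) (ν := κ)).prod (MeasurePreserving.id ν))
  rw [← hmp.map_eq, ← h, Measure.map_map hmp.measurable ((hA.prodMk hB).prodMk hD)]
  rfl

/-! ### The decoding threshold and the Gaussian offset -/

namespace Params

variable (prm : Params)

/-- Law of the offset of the typical device. -/
noncomputable def offsetLaw : Measure ℝ := gaussianReal 0 (Real.toNNReal (prm.eta ^ 2))

instance : IsProbabilityMeasure prm.offsetLaw := by unfold offsetLaw; infer_instance

lemma antitone_gammaTail (k : Link) : Antitone (prm.gammaTail k) := fun _ _ hxy =>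
  measureReal_mono fun _ hy => hxy.trans hy

lemma measurable_gammaTail (k : Link) : Measurable (prm.gammaTail k) :=
  (prm.antitone_gammaTail k).measurable

lemma gammaTail_nonneg (k : Link) (x : ℝ≥0∞) : 0 ≤ prm.gammaTail k x := measureReal_nonneg

lemma abs_gammaTail_le_one (k : Link) (x : ℝ≥0∞) : |prm.gammaTail k x| ≤ 1 := by
  rw [gammaTail, abs_of_nonneg measureReal_nonneg]
  exact measureReal_le_one

lemma measurable_alzerTail (c : Link → ℝ) (k : Link) : Measurable (prm.alzerTail c k) := by
  have h : Measurable fun x : ℝ≥0∞ => expNeg (ENNReal.ofReal (c k) * x) :=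
    measurable_expNeg.comp (measurable_id.const_mul _)
  unfold alzerTail
  fun_prop

lemma abs_alzerTail_le_one (c : Link → ℝ) (k : Link) (x : ℝ≥0∞) :
    |prm.alzerTail c k x| ≤ 1 := by
  have h0 : 0 ≤ 1 - expNeg (ENNReal.ofReal (c k) * x) := sub_nonneg.2 (expNeg_le_one _)
  have h1 : 1 - expNeg (ENNReal.ofReal (c k) * x) ≤ 1 := by
    linarith [expNeg_nonneg (ENNReal.ofReal (c k) * x)]
  have h2 := pow_nonneg h0 (prm.m k)
  have h3 := pow_le_one₀ h0 h1 (n := prm.m k)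
  rw [alzerTail, abs_le]
  constructor <;> linarith

/-- The fading level that is required per unit of disturbance. -/
noncomputable def levelCoeff (k : Link) (r : ℝ) : ℝ :=
  prm.thetaDC * (r ^ 2 + prm.h ^ 2) ^ (prm.pathLoss k / 2) / (prm.P * prm.GdM * prm.GuM)

lemma thetaDC_pos : 0 < prm.thetaDC := by
  have h1 := prm.packetSize_pos
  have h2 := prm.tDC_pos
  have h3 := prm.zeta_pos
  have h4 := prm.W_pos
  exact sub_pos.2 (Real.one_lt_rpow one_lt_two (by positivity))

lemma levelCoeff_pos (k : Link) (r : ℝ) : 0 < prm.levelCoeff k r := by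
  have h1 := prm.thetaDC_pos
  have h2 := prm.P_pos
  have h3 := prm.GdM_pos
  have h4 := prm.GuM_pos
  have h5 := prm.h_pos
  unfold levelCoeff; positivity

lemma measurable_levelCoeff (k : Link) : Measurable (prm.levelCoeff k) := by
  unfold levelCoeff; fun_prop

lemma levelCoeff_mul (k : Link) (r : ℝ) :
    prm.levelCoeff k r * (prm.P * prm.GdM * prm.GuM * prm.attenuation k r) = prm.thetaDC := by
  have h2 := prm.P_pos
  have h3 := prm.GdM_pos
  have h4 := prm.GuM_pos
  have h5 := prm.h_pos
  have h6 : 0 < r ^ 2 + prm.h ^ 2 := by positivity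
  have h7 : (r ^ 2 + prm.h ^ 2) ^ (prm.pathLoss k / 2) ≠ 0 := (Real.rpow_pos_of_pos h6 _).ne'
  rw [levelCoeff, attenuation, neg_div, Real.rpow_neg h6.le]
  field_simp

lemma le_div_iff_levelCoeff_mul_le (k : Link) (r : ℝ) {x : ℝ} (hx : 0 < x) (d : ℝ≥0∞) :
    ENNReal.ofReal prm.thetaDC ≤
      ENNReal.ofReal (prm.P * x * prm.GdM * prm.GuM * prm.attenuation k r) / d ↔
    ENNReal.ofReal (prm.levelCoeff k r) * d ≤ ENNReal.ofReal x := by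
  have h2 := prm.P_pos
  have h3 := prm.GdM_pos
  have h4 := prm.GuM_pos
  have h5 := prm.attenuation_pos k r
  set c := prm.P * prm.GdM * prm.GuM * prm.attenuation k r with hc
  have hc0 : 0 < c := by positivity
  -- The side conditions are met by the numerator, positive and finite, so `d` may be `0` or `∞`. A
  -- zero gain would fail here, since `0 / 0 = 0`.
  rw [ENNReal.le_div_iff_mul_le (Or.inr (ENNReal.ofReal_pos.2 (by positivity)).ne')
    (Or.inr ENNReal.ofReal_ne_top), ← prm.levelCoeff_mul k r, ← hc,
    show prm.P * x * prm.GdM * prm.GuM * prm.attenuation k r = c * x by rw [hc]; ring,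
    mul_comm _ c, ENNReal.ofReal_mul hc0.le, ENNReal.ofReal_mul hc0.le, mul_assoc]
  exact ENNReal.mul_le_mul_iff_right (ENNReal.ofReal_pos.2 hc0).ne' ENNReal.ofReal_ne_top

lemma fadingLaw_Iic_zero (k : Link) : prm.fadingLaw k (Set.Iic 0) = 0 := by
  have h := prm.cdf_fadingLaw k le_rfl
  rw [cdf_eq_real] at h
  simpa [fadingCDF, measureReal_eq_zero_iff] using h

lemma integral_offsetLaw (f : ℝ → ℝ) : ∫ r, f r ∂prm.offsetLaw =
    ∫ r, f r * (1 / √(2 * Real.pi * prm.eta ^ 2) * Real.exp (-r ^ 2 / (2 * prm.eta ^ 2))) := by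
  have he : 0 < prm.eta ^ 2 := pow_pos prm.eta_pos 2
  rw [offsetLaw, integral_gaussianReal_eq_integral_smul (Real.toNNReal_pos.2 he).ne']
  refine integral_congr_ae (ae_of_all _ fun r => ?_)
  simp only [gaussianPDFReal, Real.coe_toNNReal _ he.le, smul_eq_mul, sub_zero, one_div]
  ring

lemma integrable_offset_density : Integrable fun r : ℝ =>
    1 / √(2 * Real.pi * prm.eta ^ 2) * Real.exp (-r ^ 2 / (2 * prm.eta ^ 2)) := by
  have he : 0 < prm.eta ^ 2 := pow_pos prm.eta_pos 2
  have h := integrable_gaussianPDFReal 0 (Real.toNNReal (prm.eta ^ 2))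
  unfold gaussianPDFReal at h
  simpa only [Real.coe_toNNReal _ he.le, sub_zero, one_div] using h

lemma integrable_mixture {f : Link → ℝ → ℝ} (hf : ∀ k, Measurable (f k))
    (hb : ∀ k r, |f k r| ≤ 1) : Integrable (prm.mixture f) := by
  have hp := prm.measurable_pLOS
  have h1 := hf Link.LOS
  have h2 := hf Link.NLOS
  unfold mixture
  refine prm.integrable_offset_density.bdd_mul (c := 1)
    (Measurable.aestronglyMeasurable (by fun_prop)) (ae_of_all _ fun r => ?_)
  have hq := prm.pLOS_mem_Icc r
  rw [Real.norm_eq_abs]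
  calc _ ≤ |f Link.LOS r * prm.pLOS r| + |f Link.NLOS r * (1 - prm.pLOS r)| := abs_add_le _ _
    _ = |f Link.LOS r| * prm.pLOS r + |f Link.NLOS r| * (1 - prm.pLOS r) := by
      rw [abs_mul, abs_mul, abs_of_nonneg hq.1, abs_of_nonneg (sub_nonneg.2 hq.2)]
    _ ≤ 1 * prm.pLOS r + 1 * (1 - prm.pLOS r) :=
      add_le_add (mul_le_mul_of_nonneg_right (hb _ _) hq.1)
        (mul_le_mul_of_nonneg_right (hb _ _) (sub_nonneg.2 hq.2))
    _ = 1 := by ring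

lemma mixture_mono {f₁ f₂ : Link → ℝ → ℝ} (h : ∀ k r, f₁ k r ≤ f₂ k r) (r : ℝ) :
    prm.mixture f₁ r ≤ prm.mixture f₂ r := by
  have hq := prm.pLOS_mem_Icc r
  have hq' := sub_nonneg.2 hq.2
  exact mul_le_mul_of_nonneg_right (add_le_add (mul_le_mul_of_nonneg_right (h _ _) hq.1)
    (mul_le_mul_of_nonneg_right (h _ _) hq')) (by positivity)

end Params

/-! ### Independence and conditioning for the intended link -/

namespace Model

variable {prm : Params} {Ω : Type*} [MeasurableSpace Ω] {μ : Measure Ω} (M : Model prm μ)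

lemma disturbance_eq (ω : Ω) : M.disturbance ω =
    ∑' i, prm.weightedPower (fun _ => 1) (M.X i ω) (M.mark i ω) + ENNReal.ofReal prm.sigmaSq := by
  rw [← M.interference_add_interference, disturbance]
  simp

lemma fadingLevel_eq (k : Link) (r : ℝ) (ω : Ω) :
    M.fadingLevel k r ω = ENNReal.ofReal (prm.levelCoeff k r) * M.disturbance ω := rfl

lemma measurable_typical :
    Measurable fun ω => (M.rx ω, M.U0 ω, M.H0 Link.LOS ω, M.H0 Link.NLOS ω) :=
  M.measurable_rx.prodMk (M.measurable_U0.prodMk ((M.measurable_H0 _).prodMk (M.measurable_H0 _)))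

/-- The disturbance is a measurable function of the sequences of positions and marks, from which the
typical device is independent. -/
lemma indepFun_typical_disturbance :
    IndepFun (fun ω => (M.rx ω, M.U0 ω, M.H0 Link.LOS ω, M.H0 Link.NLOS ω)) M.disturbance μ := by
  let d : (ℕ → Plane) × (ℕ → ℝ × ℝ × ℝ × ℝ) → ℝ≥0∞ := fun z =>
    ∑' i, prm.weightedPower (fun _ => 1) (z.1 i) (z.2 i) + ENNReal.ofReal prm.sigmaSq
  have hd : Measurable d := by
    refine Measurable.add (Measurable.tsum fun i => ?_) measurable_const
    have : Measurable fun z : (ℕ → Plane) × (ℕ → ℝ × ℝ × ℝ × ℝ) => (z.1 i, z.2 i) := by fun_prop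
    exact (prm.measurable_weightedPower fun _ => 1).comp this
  have h := M.typical_indep.comp measurable_id hd
  exact h.congr (ae_of_all _ fun ω => rfl) (ae_of_all _ fun ω => (M.disturbance_eq ω).symm)

lemma map_selector_fading (k : Link) :
    μ.map (fun ω => ((M.rx ω, M.U0 ω), M.H0 k ω)) =
      (prm.offsetLaw.prod (volume.restrict (Set.Icc (0 : ℝ) 1))).prod (prm.fadingLaw k) := by
  have hassoc := (measurePreserving_prodAssoc prm.offsetLaw (volume.restrict (Set.Icc (0 : ℝ) 1))
    ((prm.fadingLaw Link.LOS).prod (prm.fadingLaw Link.NLOS))).symm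
  have htyp : MeasurePreserving (fun ω => (M.rx ω, M.U0 ω, M.H0 Link.LOS ω, M.H0 Link.NLOS ω)) μ
      _ := ⟨M.measurable_typical, M.typical_law⟩
  cases k
  · exact (((MeasurePreserving.id _).prod measurePreserving_fst).comp (hassoc.comp htyp)).map_eq
  · exact (((MeasurePreserving.id _).prod measurePreserving_snd).comp (hassoc.comp htyp)).map_eq

lemma measurable_selector_disturbance :
    Measurable fun ω => ((M.rx ω, M.U0 ω), M.disturbance ω) :=
  (M.measurable_rx.prodMk M.measurable_U0).prodMk M.measurable_disturbance

lemma condSuccessWithTail_eq_integral_map {T : Link → ℝ≥0∞ → ℝ}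
    (hT : ∀ k, Measurable (T k))
    (k : Link) (r : ℝ) :
    M.condSuccessWithTail T k r =
      ∫ d, T k (ENNReal.ofReal (prm.levelCoeff k r) * d) ∂(μ.map M.disturbance) :=
  (integral_map M.measurable_disturbance.aemeasurable
    ((hT k).comp (measurable_id.const_mul _)).aestronglyMeasurable).symm

variable [IsProbabilityMeasure μ]

instance : IsProbabilityMeasure (μ.map M.disturbance) :=
  Measure.isProbabilityMeasure_map M.measurable_disturbance.aemeasurable

/-- The gain is isolated as the first factor, so that slices of an event over the remaining
variables are measured by the fading law. -/
lemma map_fading_selector_disturbance (k : Link) :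
    μ.map (fun ω => (M.H0 k ω, ((M.rx ω, M.U0 ω), M.disturbance ω))) =
      (prm.fadingLaw k).prod ((prm.offsetLaw.prod (volume.restrict (Set.Icc (0 : ℝ) 1))).prod
        (μ.map M.disturbance)) := by
  refine map_prodMk_rotate (M.measurable_rx.prodMk M.measurable_U0) (M.measurable_H0 k)
    M.measurable_disturbance ?_
  have hind : IndepFun (fun ω => ((M.rx ω, M.U0 ω), M.H0 k ω)) M.disturbance μ := by
    cases k
    · have h : Measurable fun t : ℝ × ℝ × ℝ × ℝ => ((t.1, t.2.1), t.2.2.1) := by fun_prop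
      exact M.indepFun_typical_disturbance.comp h measurable_id
    · have h : Measurable fun t : ℝ × ℝ × ℝ × ℝ => ((t.1, t.2.1), t.2.2.2) := by fun_prop
      exact M.indepFun_typical_disturbance.comp h measurable_id
  rw [← M.map_selector_fading k]
  exact (indepFun_iff_map_prod_eq_prod_map_map
    ((M.measurable_rx.prodMk M.measurable_U0).prodMk (M.measurable_H0 k)).aemeasurable
    M.measurable_disturbance.aemeasurable).1 hind

lemma map_selector_disturbance :
    μ.map (fun ω => ((M.rx ω, M.U0 ω), M.disturbance ω)) =
      (prm.offsetLaw.prod (volume.restrict (Set.Icc (0 : ℝ) 1))).prod (μ.map M.disturbance) := by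
  have h : MeasurePreserving _ μ _ :=
    ⟨(M.measurable_H0 Link.LOS).prodMk M.measurable_selector_disturbance,
      M.map_fading_selector_disturbance Link.LOS⟩
  exact (measurePreserving_snd.comp h).map_eq

/-- Integrating out the fading gain of the intended link. -/
lemma measureReal_le_fading (k : Link) {b : (ℝ × ℝ) × ℝ≥0∞ → ℝ≥0∞} (hb : Measurable b) :
    μ.real {ω | b ((M.rx ω, M.U0 ω), M.disturbance ω) ≤ ENNReal.ofReal (M.H0 k ω)} =
      ∫ ω, prm.gammaTail k (b ((M.rx ω, M.U0 ω), M.disturbance ω)) ∂μ := by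
  have hW := M.measurable_selector_disturbance
  have hS : MeasurableSet {p : ℝ × ((ℝ × ℝ) × ℝ≥0∞) | b p.2 ≤ ENNReal.ofReal p.1} :=
    measurableSet_le (hb.comp measurable_snd) (by fun_prop)
  have hg : Measurable fun w => prm.gammaTail k (b w) := (prm.measurable_gammaTail k).comp hb
  have h1 : μ {ω | b ((M.rx ω, M.U0 ω), M.disturbance ω) ≤ ENNReal.ofReal (M.H0 k ω)} =
      ∫⁻ w, prm.fadingLaw k {y | b w ≤ ENNReal.ofReal y}
        ∂(μ.map fun ω => ((M.rx ω, M.U0 ω), M.disturbance ω)) := by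
    rw [M.map_selector_disturbance]
    have h := Measure.prod_apply_symm (μ := prm.fadingLaw k) (ν := (prm.offsetLaw.prod
      (volume.restrict (Set.Icc (0 : ℝ) 1))).prod (μ.map M.disturbance)) hS
    rw [← M.map_fading_selector_disturbance k,
      Measure.map_apply ((M.measurable_H0 k).prodMk hW) hS] at h
    exact h
  have h2 := integral_map (μ := μ) hW.aemeasurable (f := fun w => prm.gammaTail k (b w))
    hg.aestronglyMeasurable
  rw [← h2, measureReal_def, h1, integral_eq_lintegral_of_nonneg_ae
    (ae_of_all _ fun w => prm.gammaTail_nonneg k (b w)) hg.aestronglyMeasurable]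
  simp [Params.gammaTail, measureReal_def]

lemma ae_fading_pos (k : Link) : ∀ᵐ ω ∂μ, 0 < M.H0 k ω := by
  have h := M.map_fading_selector_disturbance k
  have hm := (M.measurable_H0 k).prodMk M.measurable_selector_disturbance
  have h1 : μ.map (M.H0 k) = prm.fadingLaw k := by
    have h : MeasurePreserving _ μ _ := ⟨hm, h⟩
    exact (measurePreserving_fst.comp h).map_eq
  have h2 := prm.fadingLaw_Iic_zero k
  rw [← h1, Measure.map_apply (M.measurable_H0 k) measurableSet_Iic] at h2
  rw [ae_iff]
  simpa [Set.preimage, not_lt] using h2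

lemma condSuccessProb_eq (k : Link) (r : ℝ) :
    M.condSuccessProb k r = M.condSuccessWithTail prm.gammaTail k r := by
  have h := M.measureReal_le_fading k
    (b := fun w => ENNReal.ofReal (prm.levelCoeff k r) * w.2) (measurable_snd.const_mul _)
  rw [condSuccessWithTail, condSuccessProb]
  refine Eq.trans (measureReal_congr ?_) h
  filter_upwards [M.ae_fading_pos k] with ω hω
  exact propext (prm.le_div_iff_levelCoeff_mul_le k r hω (M.disturbance ω))

/-- The level for the fading gain of the intended link in the state `k`, and `∞` if the link is in
the other state. -/
noncomputable def selectedLevel (prm : Params) (k : Link) (w : (ℝ × ℝ) × ℝ≥0∞) : ℝ≥0∞ :=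
  if prm.linkOf w.1.1 w.1.2 = k then ENNReal.ofReal (prm.levelCoeff k w.1.1) * w.2 else ∞

lemma measurableSet_linkOf (prm : Params) (k : Link) :
    MeasurableSet {p : ℝ × ℝ | prm.linkOf p.1 p.2 = k} := by
  have h : MeasurableSet {p : ℝ × ℝ | p.2 ≤ prm.pLOS p.1} :=
    measurableSet_le measurable_snd (prm.measurable_pLOS.comp measurable_fst)
  cases k
  · simpa only [prm.linkOf_eq_LOS_iff] using h
  · simp only [prm.linkOf_eq_NLOS_iff]
    exact h.compl

lemma measurable_selectedLevel (prm : Params) (k : Link) : Measurable (selectedLevel prm k) := by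
  have := prm.measurable_levelCoeff k
  exact Measurable.ite ((measurableSet_linkOf prm k).preimage measurable_fst) (by fun_prop)
    measurable_const

/-- Which gain matters depends on the random state, so success is split into one event per state. In
the wrong state the level is `∞`, which no gain reaches: the events are disjoint, and since the tail
at `∞` is `0` only the actual state contributes to the sum of means. -/
lemma successProb_eq : M.successProb = M.successWithTail prm.gammaTail := by
  let S : Link → Set Ω := fun k => {ω | selectedLevel prm k ((M.rx ω, M.U0 ω), M.disturbance ω) ≤
    ENNReal.ofReal (M.H0 k ω)}
  have hl : ∀ k, Measurable fun ω =>
      selectedLevel prm k ((M.rx ω, M.U0 ω), M.disturbance ω) := fun k =>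
    (measurable_selectedLevel prm k).comp M.measurable_selector_disturbance
  have hS : ∀ k, MeasurableSet (S k) := fun k =>
    measurableSet_le (hl k) (M.measurable_H0 k).ennreal_ofReal
  have hlink : ∀ k ω, ω ∈ S k → M.link0 ω = k := fun k ω hω => by
    by_contra hne
    have : selectedLevel prm k ((M.rx ω, M.U0 ω), M.disturbance ω) = ∞ := if_neg hne
    simp [S, this] at hω
  have hdisj : Disjoint (S Link.LOS) (S Link.NLOS) := Set.disjoint_left.2 fun ω h1 h2 => by
    have := (hlink _ _ h1).symm.trans (hlink _ _ h2)
    cases this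
  have hlevel : ∀ ω, selectedLevel prm (M.link0 ω) ((M.rx ω, M.U0 ω), M.disturbance ω) =
      M.fadingLevel (M.link0 ω) (M.rx ω) ω := fun ω => if_pos rfl
  have htop : ∀ k ω, k ≠ M.link0 ω →
      selectedLevel prm k ((M.rx ω, M.U0 ω), M.disturbance ω) = ∞ := fun k ω h => if_neg h.symm
  have h1 : M.successProb = μ.real (S Link.LOS ∪ S Link.NLOS) := by
    refine measureReal_congr ?_
    filter_upwards [M.ae_fading_pos Link.LOS, M.ae_fading_pos Link.NLOS] with ω h1 h2
    have hpos : 0 < M.H0 (M.link0 ω) ω := by cases M.link0 ω <;> assumption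
    refine propext (Iff.trans
      (prm.le_div_iff_levelCoeff_mul_le (M.link0 ω) (M.rx ω) hpos (M.disturbance ω)) ?_)
    rw [← M.fadingLevel_eq, ← hlevel]
    change ω ∈ S (M.link0 ω) ↔ ω ∈ S Link.LOS ∪ S Link.NLOS
    constructor
    · intro h
      cases hk : M.link0 ω <;> rw [hk] at h
      · exact Or.inl h
      · exact Or.inr h
    · rintro (h | h) <;> rwa [hlink _ _ h]
  have hint : ∀ k, Integrable (fun ω =>
      prm.gammaTail k (selectedLevel prm k ((M.rx ω, M.U0 ω), M.disturbance ω))) μ := fun k =>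
    Integrable.of_bound ((prm.measurable_gammaTail k).comp (hl k)).aestronglyMeasurable 1
      (ae_of_all _ fun ω => prm.abs_gammaTail_le_one k _)
  rw [h1, measureReal_union hdisj (hS _), M.measureReal_le_fading _ (measurable_selectedLevel _ _),
    M.measureReal_le_fading _ (measurable_selectedLevel _ _), ← integral_add (hint _) (hint _),
    successWithTail]
  refine integral_congr_ae (ae_of_all _ fun ω => ?_)
  simp only [← hlevel]
  cases hk : M.link0 ω
  · rw [htop Link.NLOS ω (by simp [hk]), prm.gammaTail_top, add_zero]
  · rw [htop Link.LOS ω (by simp [hk]), prm.gammaTail_top, zero_add]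

section Tail

variable {T : Link → ℝ≥0∞ → ℝ}

lemma measurable_tail_level (hT : ∀ k, Measurable (T k)) (k : Link) :
    Measurable fun p : ℝ × ℝ≥0∞ =>
    T k (ENNReal.ofReal (prm.levelCoeff k p.1) * p.2) := by
  have := prm.measurable_levelCoeff k
  have := hT k
  fun_prop

lemma measurable_condSuccessWithTail (hT : ∀ k, Measurable (T k)) (k : Link) :
    Measurable (M.condSuccessWithTail T k) := by
  rw [funext (M.condSuccessWithTail_eq_integral_map hT k)]
  exact (measurable_tail_level hT k).stronglyMeasurable.integral_prod_right'.measurable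

lemma abs_condSuccessWithTail_le_one (hb : ∀ k x, |T k x| ≤ 1) (k : Link) (r : ℝ) :
    |M.condSuccessWithTail T k r| ≤ 1 := by
  simpa [condSuccessWithTail] using norm_integral_le_of_norm_le_const (μ := μ) (C := 1)
    (f := fun ω => T k (M.fadingLevel k r ω)) (ae_of_all _ fun ω => hb k _)

lemma integrable_mixture_condSuccessWithTail (hT : ∀ k, Measurable (T k))
    (hb : ∀ k x, |T k x| ≤ 1) :
    Integrable (prm.mixture (M.condSuccessWithTail T)) :=
  prm.integrable_mixture (M.measurable_condSuccessWithTail hT)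
    (M.abs_condSuccessWithTail_le_one hb)

/-- Conditioning on the offset and the state of the intended link. -/
theorem successWithTail_eq_integral_mixture (hT : ∀ k, Measurable (T k))
    (hb : ∀ k x, |T k x| ≤ 1) :
    M.successWithTail T = ∫ r, prm.mixture (M.condSuccessWithTail T) r := by
  let Φ : (ℝ × ℝ) × ℝ≥0∞ → ℝ := fun w => if w.1.2 ≤ prm.pLOS w.1.1 then
    T Link.LOS (ENNReal.ofReal (prm.levelCoeff Link.LOS w.1.1) * w.2) else
    T Link.NLOS (ENNReal.ofReal (prm.levelCoeff Link.NLOS w.1.1) * w.2)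
  have hp := prm.measurable_pLOS
  have hΦ : Measurable Φ := by
    have hr : Measurable fun w : (ℝ × ℝ) × ℝ≥0∞ => (w.1.1, w.2) := by fun_prop
    have hset : MeasurableSet {w : (ℝ × ℝ) × ℝ≥0∞ | w.1.2 ≤ prm.pLOS w.1.1} :=
      measurableSet_le (by fun_prop) (by fun_prop)
    have hk := fun k => (measurable_tail_level (prm := prm) hT k).comp hr
    exact Measurable.ite hset (hk Link.LOS) (hk Link.NLOS)
  have hΦb : ∀ w, ‖Φ w‖ ≤ 1 := fun w => by
    simp only [Φ]; split_ifs <;> exact hb _ _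
  have hcond : ∀ z : ℝ × ℝ, ∫ d, Φ (z, d) ∂(μ.map M.disturbance) = if z.2 ≤ prm.pLOS z.1 then
      M.condSuccessWithTail T Link.LOS z.1 else M.condSuccessWithTail T Link.NLOS z.1 :=
    fun z => by
      simp only [M.condSuccessWithTail_eq_integral_map hT]
      by_cases h : z.2 ≤ prm.pLOS z.1
      · simp only [Φ, h, if_true]
      · simp only [Φ, h, if_false]
  have h1 : M.successWithTail T = ∫ w, Φ w ∂((prm.offsetLaw.prod
      (volume.restrict (Set.Icc (0 : ℝ) 1))).prod (μ.map M.disturbance)) := by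
    rw [← M.map_selector_disturbance, integral_map M.measurable_selector_disturbance.aemeasurable
      hΦ.aestronglyMeasurable, successWithTail]
    refine integral_congr_ae (ae_of_all _ fun ω => ?_)
    simp only [Φ, link0, Params.linkOf, M.fadingLevel_eq]
    split_ifs <;> rfl
  have hint : Integrable Φ ((prm.offsetLaw.prod (volume.restrict (Set.Icc (0 : ℝ) 1))).prod
      (μ.map M.disturbance)) :=
    Integrable.of_bound hΦ.aestronglyMeasurable 1 (ae_of_all _ hΦb)
  -- Fubini with the disturbance innermost, then the selector, then the offset: conditional success,
  -- mixture weights, Gaussian density.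
  rw [h1, integral_prod _ hint, integral_prod _ hint.integral_prod_left]
  simp only [hcond, Params.integral_ite_le (prm.pLOS_mem_Icc _)]
  rw [prm.integral_offsetLaw]
  refine integral_congr_ae (ae_of_all _ fun r => ?_)
  simp only [Params.mixture]
  ring

end Tail

/-! ### The closed form from the binomial expansion -/

lemma integral_expNeg_disturbance {a : ℝ} (ha : 0 ≤ a) :
    ∫ ω, expNeg (ENNReal.ofReal a * M.disturbance ω) ∂μ =
      Real.exp (-(a * prm.sigmaSq)) * prm.laplace Link.LOS a * prm.laplace Link.NLOS a := by
  simp only [disturbance, mul_add, expNeg_add (_ + _)]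
  rw [integral_mul_const, M.integral_expNeg_interference (s := fun _ => a) fun _ => ha,
    ← ENNReal.ofReal_mul ha, expNeg_ofReal (mul_nonneg ha prm.sigmaSq_nonneg)]
  ring

lemma one_sub_one_sub_pow (x : ℝ) (m : ℕ) : 1 - (1 - x) ^ m =
    ∑ n ∈ Finset.Icc 1 m, (-1 : ℝ) ^ (n + 1) * (m.choose n : ℝ) * x ^ n := by
  have h := add_pow (-x) 1 m
  -- The term `n = 0` is split off because it cancels the leading `1`.
  rw [Finset.range_eq_Ico, Finset.sum_eq_sum_Ico_succ_bot (Nat.succ_pos m)] at h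
  rw [sub_eq_neg_add 1 x, h]
  have hI : Finset.Ico (0 + 1) (m + 1) = Finset.Icc 1 m := by ext; simp
  simp only [hI, pow_zero, one_pow, Nat.choose_zero_right, Nat.cast_one, mul_one,
    sub_add_cancel_left, ← Finset.sum_neg_distrib]
  refine Finset.sum_congr rfl fun n _ => ?_
  rw [neg_pow]; ring

/-- The `n`-th power of the exponential in Alzer's tail is an exponential with `n` times the
coefficient, which is `arg`; each term is then a Laplace transform of the disturbance. -/
theorem condSuccessWithTail_alzerTail {c : Link → ℝ} (hc : ∀ k, 0 ≤ c k) (k : Link) (r : ℝ) :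
    M.condSuccessWithTail (prm.alzerTail c) k r = prm.condFormula c k r := by
  have harg : ∀ n, prm.arg c k r n = n * (c k * prm.levelCoeff k r) := fun n => by
    rw [Params.arg, Params.levelCoeff]; ring
  have hl := prm.levelCoeff_pos k r
  have hck := hc k
  have hpow : ∀ (n : ℕ) ω, expNeg (ENNReal.ofReal (c k) * M.fadingLevel k r ω) ^ n =
      expNeg (ENNReal.ofReal (prm.arg c k r n) * M.disturbance ω) := fun n ω => by
    rw [← expNeg_natCast_mul, harg, ENNReal.ofReal_mul (Nat.cast_nonneg n),
      ENNReal.ofReal_mul hck, ENNReal.ofReal_natCast, M.fadingLevel_eq, mul_assoc, mul_assoc]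
  have hm : ∀ n, Measurable fun ω => ENNReal.ofReal (prm.arg c k r n) * M.disturbance ω :=
    fun n => M.measurable_disturbance.const_mul _
  simp only [condSuccessWithTail, Params.alzerTail, one_sub_one_sub_pow, hpow]
  rw [integral_finsetSum _ fun n _ => (integrable_expNeg (hm n)).const_mul _, Params.condFormula]
  refine Finset.sum_congr rfl fun n _ => ?_
  rw [integral_const_mul, M.integral_expNeg_disturbance (by rw [harg]; positivity)]
  ring

lemma condSuccessWithTail_mono {T₁ T₂ : Link → ℝ≥0∞ → ℝ} (hT₁ : ∀ k, Measurable (T₁ k))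
    (hb₁ : ∀ k x, |T₁ k x| ≤ 1) (hT₂ : ∀ k, Measurable (T₂ k)) (hb₂ : ∀ k x, |T₂ k x| ≤ 1)
    (h : ∀ k x, T₁ k x ≤ T₂ k x) (k : Link) (r : ℝ) :
    M.condSuccessWithTail T₁ k r ≤ M.condSuccessWithTail T₂ k r := by
  have hm : Measurable fun ω => M.fadingLevel k r ω := M.measurable_disturbance.const_mul _
  exact integral_mono
    (Integrable.of_bound ((hT₁ k).comp hm).aestronglyMeasurable 1 (ae_of_all _ fun _ => hb₁ _ _))
    (Integrable.of_bound ((hT₂ k).comp hm).aestronglyMeasurable 1 (ae_of_all _ fun _ => hb₂ _ _))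
    fun ω => h k _

end Model

end URDC

/-! ### The main theorem -/

theorem theorem1 (prm : URDC.Params) {Ω : Type*} [MeasurableSpace Ω]
    (μ : MeasureTheory.Measure Ω) [MeasureTheory.IsProbabilityMeasure μ]
    (M : URDC.Model prm μ) :
    -- the functions in the closed form are the Laplace transforms of the interference
    (∀ (k : URDC.Link) (s : ℝ), 0 ≤ s →
      ∫ ω, URDC.expNeg (ENNReal.ofReal s * M.interference k ω) ∂μ = prm.laplace k s) ∧
    -- exact success probability through the exact tail of the fading gain
    (∀ (k : URDC.Link) (r : ℝ),
      M.condSuccessProb k r = M.condSuccessWithTail prm.gammaTail k r) ∧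
    M.successProb = M.successWithTail prm.gammaTail ∧
    MeasureTheory.Integrable (prm.mixture M.condSuccessProb) ∧
    M.successProb = ∫ r, prm.mixture M.condSuccessProb r ∧
    -- with the approximated tail, the success probability is the closed form
    (∀ (k : URDC.Link) (r : ℝ),
      M.condSuccessWithTail (prm.alzerTail prm.g) k r = prm.condFormula prm.g k r) ∧
    MeasureTheory.Integrable (prm.mixture (prm.condFormula prm.g)) ∧
    M.successWithTail (prm.alzerTail prm.g) = prm.successFormula prm.g ∧
    -- position of the exact success probability with respect to the closed form
    (∀ (k : URDC.Link) (r : ℝ),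
      prm.condFormula (fun l => (prm.m l : ℝ)) k r ≤ M.condSuccessProb k r ∧
        M.condSuccessProb k r ≤ prm.condFormula prm.g k r) ∧
    MeasureTheory.Integrable (prm.mixture (prm.condFormula (fun l => (prm.m l : ℝ)))) ∧
    prm.successFormula (fun l => (prm.m l : ℝ)) ≤ M.successProb ∧
    M.successProb ≤ prm.successFormula prm.g := by
  have hm : ∀ k, (0 : ℝ) ≤ prm.m k := fun k => Nat.cast_nonneg _
  have hg : ∀ k, 0 ≤ prm.g k := fun k => (prm.g_pos k).le
  have hexact : M.condSuccessProb = M.condSuccessWithTail prm.gammaTail :=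
    funext fun k => funext fun r => M.condSuccessProb_eq k r
  have hfg : M.condSuccessWithTail (prm.alzerTail prm.g) = prm.condFormula prm.g :=
    funext fun k => funext fun r => M.condSuccessWithTail_alzerTail hg k r
  have hfm : M.condSuccessWithTail (prm.alzerTail fun l => (prm.m l : ℝ)) =
      prm.condFormula fun l => (prm.m l : ℝ) :=
    funext fun k => funext fun r => M.condSuccessWithTail_alzerTail hm k r
  have hint := M.integrable_mixture_condSuccessWithTail prm.measurable_gammaTail
    prm.abs_gammaTail_le_one
  have hintg := M.integrable_mixture_condSuccessWithTail (prm.measurable_alzerTail prm.g)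
    (prm.abs_alzerTail_le_one prm.g)
  have hintm := M.integrable_mixture_condSuccessWithTail
    (prm.measurable_alzerTail fun l => (prm.m l : ℝ)) (prm.abs_alzerTail_le_one _)
  have hmix := M.successWithTail_eq_integral_mixture prm.measurable_gammaTail
    prm.abs_gammaTail_le_one
  have hmixg := M.successWithTail_eq_integral_mixture (prm.measurable_alzerTail prm.g)
    (prm.abs_alzerTail_le_one prm.g)
  have hle := M.condSuccessWithTail_mono (prm.measurable_alzerTail fun l => (prm.m l : ℝ))
    (prm.abs_alzerTail_le_one _) prm.measurable_gammaTail prm.abs_gammaTail_le_one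
    prm.alzerTail_le_gammaTail
  have hge := M.condSuccessWithTail_mono prm.measurable_gammaTail prm.abs_gammaTail_le_one
    (prm.measurable_alzerTail prm.g) (prm.abs_alzerTail_le_one prm.g) prm.gammaTail_le_alzerTail
  have hprob : M.successProb = ∫ r, prm.mixture M.condSuccessProb r := by
    rw [M.successProb_eq, hmix, hexact]
  rw [hfg] at hintg hmixg hge
  rw [hfm] at hintm hle
  rw [← hexact] at hint hle hge
  refine ⟨fun k s hs => M.integral_expNeg_mul_interference k hs, M.condSuccessProb_eq,
    M.successProb_eq, hint, hprob, M.condSuccessWithTail_alzerTail hg, hintg, hmixg,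
    fun k r => ⟨hle k r, hge k r⟩, hintm, ?_, ?_⟩
  · rw [hprob]
    exact MeasureTheory.integral_mono hintm hint (prm.mixture_mono hle)
  · rw [hprob]
    exact MeasureTheory.integral_mono hint hintg (prm.mixture_mono hge)
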